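/- **Theorem 3.3.** Let $T$ be a rank-one transformation on a probability space $(Y,\mu)$, i.e. a measure-preserving map constructed by cutting and stacking with a cut sequence $(r_n)_{n\ge 1}$, $r_n\ge 1$, and a spacer sequence $(s_{n,i})_{0\le i\le r_n}$, $s_{n,i}\ge 0$: starting from a column $C_1$ of height $1$, the column $C_{n+1}$ is obtained by cutting $C_n$ into $r_n+1$ subcolumns of equal width, placing $s_{n,i}$ spacer levels on top of the $i$-th subcolumn, and stacking these in order; $T$ moves each level of a column, except the top one, to the level directly above it, and (modulo null sets) the columns fill $Y$ and their levels generate the $\sigma$-algebra. Assume that $T$ is not an odometer, i.e. $T$ cannot be constructed by cutting and stacking with sequences $(r'_n)$, $(s'_{n,i})$ for which there is $N$ with $s'_{n,i}=0$ for all $n\ge N$ and $0\le i\le r'_n$. Let $B_1=0$ and $B_{n+1}=B_n1^{s_{n,0}}B_n1^{s_{n,1}}\cdots B_n1^{s_{n,r_n}}$, let $X\subseteq\{0,1\}^{\mathbb Z}$ be the associated subshift, consisting of all biinfinite sequences every finite subword of which is a subword of some $B_n$, and let $p(q)$ be the number of words of length $q$ that occur in elements of $X$. Then $$\limsup_{q\to\infty}\,\bigl(p(q)-1.5\,q\bigr)=\infty\qquad\text{and}\qquad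 \liminf_{q\to\infty}\,\bigl(p(q)-q\bigr)=\infty .$$ -/

import Mathlib

open MeasureTheory Filter

/-- The number of cuts `r n ≥ 1` made in the `n`-th column and the number `s n i` of spacers put on
top of its `i`-th subcolumn, `0 ≤ i ≤ r n`. Columns are numbered from `0`; the values `s n i` with
`i > r n` are never used. -/
structure CuttingData where
  r : ℕ → ℕ
  s : ℕ → ℕ → ℕ
  one_le_r : ∀ n, 1 ≤ r n

namespace CuttingData

/-- The height of the `n`-th column: it starts at `1`, and column `n + 1` is made of the `r n + 1`
subcolumns of column `n`, each with its spacers. -/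
def height (D : CuttingData) : ℕ → ℕ
  | 0 => 1
  | n + 1 => ∑ i ∈ Finset.range (D.r n + 1), (height D n + D.s n i)

/-- The height in column `n + 1` at which the `i`-th subcolumn of column `n` begins. -/
def offset (D : CuttingData) (n i : ℕ) : ℕ :=
  ∑ l ∈ Finset.range i, (D.height n + D.s n l)

/-- The words `B n`: `B 0 = 0` and `B (n+1) = B n 1^{s n 0} B n 1^{s n 1} ⋯ B n 1^{s n (r n)}`. -/
def word (D : CuttingData) : ℕ → List (Fin 2)
  | 0 => [0]
  | n + 1 => (List.range (D.r n + 1)).flatMap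
      (fun i => word D n ++ List.replicate (D.s n i) 1)

/-- `IsColumns D μ T I` says that the sets `I n j`, `0 ≤ j < D.height n`, are the levels of the
successive columns of a cutting and stacking construction of the transformation `T` with cuts and
spacers given by `D`. Levels of one column have equal measure because `T` preserves `μ`. -/
structure IsColumns (D : CuttingData) {Y : Type*} [MeasurableSpace Y] (μ : Measure Y)
    (T : Y → Y) (I : ℕ → ℕ → Set Y) : Prop where
  measurableSet : ∀ n j, j < D.height n → MeasurableSet (I n j)
  /-- the levels of a column are pairwise disjoint -/
  disjoint : ∀ n i j, i < D.height n → j < D.height n → i ≠ j → Disjoint (I n i) (I n j)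
  /-- `T` carries each level, except the top one, to the level directly above it -/
  climb : ∀ n j, j + 1 < D.height n → T ⁻¹' (I n (j + 1)) =ᵐ[μ] I n j
  /-- each level is cut into `r n + 1` sublevels, and the subcolumns with their spacers are stacked
  in order; the remaining levels of column `n + 1` are the spacers -/
  cut : ∀ n j, j < D.height n →
    I n j = ⋃ i ∈ Finset.range (D.r n + 1), I (n + 1) (D.offset n i + j)
  /-- the columns fill the space -/
  exhaust : ∀ᵐ y ∂μ, ∃ n, ∃ j < D.height n, y ∈ I n j
  /-- every measurable set is approximated by unions of levels -/
  approx : ∀ A : Set Y, MeasurableSet A → ∀ ε : ℝ, 0 < ε →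
    ∃ n, ∃ J ⊆ Finset.range (D.height n), μ (symmDiff A (⋃ j ∈ J, I n j)) < ENNReal.ofReal ε

/-- `T` can be constructed by cutting and stacking with the cuts and spacers `D`. -/
def Constructs (D : CuttingData) {Y : Type*} [MeasurableSpace Y] (μ : Measure Y)
    (T : Y → Y) : Prop :=
  ∃ I : ℕ → ℕ → Set Y, D.IsColumns μ T I

/-- The symbolic model: all biinfinite sequences each of whose finite subwords is a subword of some
`B n`. -/
def subshift (D : CuttingData) : Set (ℤ → Fin 2) :=
  {x | ∀ (k : ℤ) (q : ℕ), ∃ n, List.ofFn (fun i : Fin q => x (k + (i : ℕ))) <:+: D.word n}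

end CuttingData

/-- `T` is an odometer: it can be constructed by cutting and stacking in such a way that from some
stage on no spacers are added. -/
def IsOdometer {Y : Type*} [MeasurableSpace Y] (μ : Measure Y) (T : Y → Y) : Prop :=
  ∃ D : CuttingData, D.Constructs μ T ∧ ∃ N, ∀ n ≥ N, ∀ i ≤ D.r n, D.s n i = 0

/-- The language of a set of biinfinite sequences: the finite words that occur in some member. -/
def subshiftLanguage {A : Type*} (X : Set (ℤ → A)) : Set (List A) :=
  {w | ∃ x ∈ X, ∃ k : ℤ, w = List.ofFn (fun i : Fin w.length => x (k + (i : ℕ)))}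

/-- The word complexity function: the number of words of length `q` in the language. -/
noncomputable def wordComplexity {A : Type*} (X : Set (ℤ → A)) (q : ℕ) : ℕ :=
  Set.ncard {w | w ∈ subshiftLanguage X ∧ w.length = q}

/-! ### Words with prescribed gaps -/

/-! Stripping the final letters `1` from the words $B_n$ gives words $P_n$ that start and end with
`0`, where $P_{n+1}$ consists of copies of $P_n$ separated by runs of `1`, the gaps. Both sequences
have the same factors, and these extend in both directions, so $p(q)$ counts them
(`wordComplexity_subshift`). Moreover $p(q+1)-p(q)$ is at least the number of right special words of
length $q$ (`complexity_add_ncard_le`).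

If the gaps became constant, then from some stage on $d$ spacers would separate consecutive
subcolumns, with none on top. Points of later columns can serve as $d$ additional top levels, and
$T$ would be an odometer (`Constructs.isOdometer`). So two gaps always recur, there is a right
special word of every length, and $p(q)-q$ is nondecreasing. Both limits follow once $p(q)-1.5q$ is
unbounded above (`exists_complexity_ge`), for which ranges of lengths with two right special words
are needed.

If every stage has three later gaps $a<b<c$, then $P_n1^a$ and $P_n1^b$ provide such a range of
length $|P_n|$ starting at $a$. Finiteness of the measure makes the least gap small compared with
$|P_n|$ infinitely often (`exists_small_gap`).

Otherwise exactly two gaps $a<b$ recur. For a word $w$ from which the $P_m$ are built with these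
gaps, the combinatorics of the gap words (`twoSpecial_of_two_gaps`) gives either a range
$(\alpha,\beta]$ with $\beta\ge 2\alpha-2a$, or a building word $Q$, at least twice as long, with a
range from about $|Q|$ to $2|Q|-|w|$. If the first happens for arbitrarily long $w$, the slope 2 on
$(\alpha,\beta]$ combines with the unboundedness of $p(q)-q$; if not, the second is iterated and the
gain accumulates. -/

/-- The word `w 1^{g₁} w 1^{g₂} ⋯ 1^{gₖ} w`. -/
def expand (w : List (Fin 2)) : List ℕ → List (Fin 2)
  | [] => w
  | c :: g => w ++ List.replicate c 1 ++ expand w g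

/-- The gap word `u g₁ u g₂ ⋯ gₖ u`. -/
def gapComp (u : List ℕ) : List ℕ → List ℕ
  | [] => u
  | c :: g => u ++ c :: gapComp u g

/-- A word which starts and ends with the letter `0`. -/
def ZeroEnded (w : List (Fin 2)) : Prop := (∃ t, w = 0 :: t) ∧ ∃ t, w = t ++ [0]

lemma expand_append_cons (w : List (Fin 2)) (g g' : List ℕ) (c : ℕ) :
    expand w (g ++ c :: g') = expand w g ++ List.replicate c 1 ++ expand w g' := by
  induction g with
  | nil => simp [expand]
  | cons d g ih => simp [expand, ih]

lemma expand_gapComp (w : List (Fin 2)) (u g : List ℕ) :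
    expand w (gapComp u g) = expand (expand w u) g := by
  induction g with
  | nil => simp [expand, gapComp]
  | cons d g ih => simp [expand, gapComp, expand_append_cons, ih]

lemma length_expand (w : List (Fin 2)) (g : List ℕ) :
    (expand w g).length = (g.length + 1) * w.length + g.sum := by
  induction g with
  | nil => simp [expand]
  | cons d g ih => simp [expand, ih]; ring

lemma gapComp_eq_append (u g : List ℕ) : ∃ t, gapComp u g = u ++ t := by
  cases g with
  | nil => exact ⟨[], by simp [gapComp]⟩
  | cons d g => exact ⟨_, rfl⟩

lemma gapComp_append_cons (u g g' : List ℕ) (c : ℕ) :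
    gapComp u (g ++ c :: g') = gapComp u g ++ c :: gapComp u g' := by
  induction g with
  | nil => simp [gapComp]
  | cons d g ih => simp [gapComp, ih]

lemma gapComp_eq_append_self (u g : List ℕ) : ∃ t, gapComp u g = t ++ u := by
  induction g with
  | nil => exact ⟨[], by simp [gapComp]⟩
  | cons d g ih =>
    obtain ⟨t, ht⟩ := ih
    exact ⟨u ++ d :: t, by simp [gapComp, ht]⟩

lemma mem_gapComp (u g : List ℕ) {x : ℕ} : x ∈ gapComp u g ↔ x ∈ u ∨ x ∈ g := by
  induction g with
  | nil => simp [gapComp]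
  | cons d g ih => simp only [gapComp, List.mem_append, List.mem_cons, ih]; tauto

lemma infix_gapComp_of_mem (u g : List ℕ) {x : ℕ} (hx : x ∈ g) :
    u ++ x :: u <:+: gapComp u g := by
  obtain ⟨s, t, rfl⟩ := List.append_of_mem hx
  rw [gapComp_append_cons]
  obtain ⟨s', hs⟩ := gapComp_eq_append_self u s
  obtain ⟨t', ht⟩ := gapComp_eq_append u t
  rw [hs, ht]
  exact ⟨s', t', by simp⟩

lemma ZeroEnded.expand {w : List (Fin 2)} (hw : ZeroEnded w) (g : List ℕ) :
    ZeroEnded (expand w g) := by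
  induction g with
  | nil => exact hw
  | cons d g ih =>
    obtain ⟨⟨t, ht⟩, -⟩ := hw
    obtain ⟨-, t', ht'⟩ := ih
    refine ⟨⟨t ++ (List.replicate d 1 ++ _root_.expand w g), ?_⟩,
      ⟨w ++ List.replicate d 1 ++ t', ?_⟩⟩
    · simp only [_root_.expand]; nth_rewrite 1 [ht]; simp
    · simp only [_root_.expand]; rw [ht']; simp

lemma ZeroEnded.length_pos {w : List (Fin 2)} (hw : ZeroEnded w) : 0 < w.length := by
  obtain ⟨⟨t, rfl⟩, -⟩ := hw; simp

lemma replicate_one_append_zero_inj {c d : ℕ} {s t : List (Fin 2)}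
    (h : List.replicate c 1 ++ 0 :: s = List.replicate d 1 ++ 0 :: t) : c = d ∧ s = t := by
  induction c generalizing d with
  | zero =>
    cases d with
    | zero => simpa using h
    | succ d => simp [List.replicate_succ] at h
  | succ c ih =>
    cases d with
    | zero => simp [List.replicate_succ] at h
    | succ d =>
      simp only [List.replicate_succ, List.cons_append, List.cons.injEq, true_and] at h
      obtain ⟨h1, h2⟩ := ih h
      exact ⟨by rw [h1], h2⟩

/-- After cancelling the first copy of `w`, the next copy starts with `0`, so the run of `1` before
it can be read off. Gap words are thus determined by the words they produce. -/
lemma expand_injective {w : List (Fin 2)} (hw : ZeroEnded w) :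
    Function.Injective (expand w) := by
  intro g
  induction g with
  | nil =>
    intro g' h
    cases g' with
    | nil => rfl
    | cons d g' =>
      have := congrArg List.length h
      have h0 := hw.length_pos
      have h1 := (hw.expand g').length_pos
      simp only [expand, List.length_append, List.length_replicate] at this
      omega
  | cons c g ih =>
    intro g' h
    cases g' with
    | nil =>
      have := congrArg List.length h
      have h0 := hw.length_pos
      have h1 := (hw.expand g).length_pos
      simp only [expand, List.length_append, List.length_replicate] at this
      omega
    | cons d g' =>
      simp only [expand, List.append_assoc, List.append_cancel_left_eq] at h
      obtain ⟨⟨t, ht⟩, -⟩ := hw.expand g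
      obtain ⟨⟨t', ht'⟩, -⟩ := hw.expand g'
      have h' := h
      rw [ht, ht'] at h'
      obtain ⟨h1, h2⟩ := replicate_one_append_zero_inj h'
      subst h1
      rw [List.append_cancel_left_eq] at h
      rw [ih h]

/-! ### Rank-one sequences of words -/

/-- A sequence of words in which each word arises from the preceding one by concatenating at least
two copies of it, with gaps filled by the letter `1`. -/
structure RankOneWords where
  P : ℕ → List (Fin 2)
  c : ℕ → List ℕ
  zeroEnded : ZeroEnded (P 0)
  c_ne_nil : ∀ n, c n ≠ []
  step : ∀ n, P (n + 1) = expand (P n) (c n)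

namespace RankOneWords

variable (S : RankOneWords)

/-- The words occurring in some word of the sequence. -/
def lang : Set (List (Fin 2)) := {u | ∃ m, u <:+: S.P m}

/-- The gaps in the words built from the `n`-th one. -/
def gaps (n : ℕ) : Set ℕ := {x | ∃ m, n ≤ m ∧ x ∈ S.c m}

/-- A word of the language with two extensions to the right. -/
def RightSpecial (u : List (Fin 2)) : Prop := u ++ [0] ∈ S.lang ∧ u ++ [1] ∈ S.lang

/-- The factors of gap words of words `S.P m` with respect to `w`. -/
def gapLang (w : List (Fin 2)) : Set (List ℕ) :=
  {g | ∃ m g', S.P m = expand w g' ∧ g <:+: g'}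

/-- All late words of the sequence are built from `w` with gaps in `G`. -/
def IsBlock (G : Set ℕ) (w : List (Fin 2)) : Prop :=
  ZeroEnded w ∧ ∃ M, ∀ m, M ≤ m → ∃ g, S.P m = expand w g ∧ ∀ x ∈ g, x ∈ G

lemma zeroEnded_P (n : ℕ) : ZeroEnded (S.P n) := by
  induction n with
  | zero => exact S.zeroEnded
  | succ n ih => rw [S.step]; exact ih.expand _

lemma exists_expand (n m : ℕ) (h : n ≤ m) :
    ∃ g, S.P m = expand (S.P n) g ∧ ∀ x ∈ g, x ∈ S.gaps n := by
  induction m, h using Nat.le_induction with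
  | base => exact ⟨[], rfl, by simp⟩
  | succ m hm ih =>
    obtain ⟨g, hg, hx⟩ := ih
    refine ⟨gapComp g (S.c m), by rw [S.step, hg, expand_gapComp], ?_⟩
    intro x h
    rcases (mem_gapComp _ _).1 h with h | h
    · exact hx x h
    · exact ⟨m, hm, h⟩

lemma isBlock_P (n : ℕ) : S.IsBlock (S.gaps n) (S.P n) :=
  ⟨S.zeroEnded_P n, n, fun m hm => S.exists_expand n m hm⟩

lemma IsBlock.mono {S : RankOneWords} {G G' : Set ℕ} {w : List (Fin 2)} (h : S.IsBlock G w)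
    (hG : G ⊆ G') : S.IsBlock G' w := by
  obtain ⟨h0, M, hM⟩ := h
  refine ⟨h0, M, fun m hm => ?_⟩
  obtain ⟨g, hg, hx⟩ := hM m hm
  exact ⟨g, hg, fun x hxg => hG (hx x hxg)⟩

lemma lang_of_infix {u v : List (Fin 2)} (h : u <:+: v) (hv : v ∈ S.lang) : u ∈ S.lang := by
  obtain ⟨m, hm⟩ := hv
  exact ⟨m, h.trans hm⟩

lemma gapLang_of_infix {w : List (Fin 2)} {u v : List ℕ} (h : u <:+: v) (hv : v ∈ S.gapLang w) :
    u ∈ S.gapLang w := by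
  obtain ⟨m, g', hm, hg⟩ := hv
  exact ⟨m, g', hm, h.trans hg⟩

lemma P_eq_expand_gapComp {w : List (Fin 2)} {m : ℕ} {g : List ℕ} (hm : S.P m = expand w g)
    (m' : ℕ) (h : m ≤ m') : ∃ g', S.P m' = expand w (gapComp g g') := by
  obtain ⟨g', hg', -⟩ := S.exists_expand m m' h
  exact ⟨g', by rw [hg', hm, expand_gapComp]⟩

/-- A gap `x` used at a stage `k ≥ m` joins two copies of `S.P k`, each of which begins and ends
with `S.P m`. -/
lemma append_gap_append_mem {w : List (Fin 2)} {m : ℕ} {v : List ℕ} (hm : S.P m = expand w v)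
    {x : ℕ} (hx : x ∈ S.gaps m) : v ++ x :: v ∈ S.gapLang w := by
  obtain ⟨k, hk, hxk⟩ := hx
  obtain ⟨g', hg'⟩ := S.P_eq_expand_gapComp hm k hk
  refine ⟨k + 1, gapComp (gapComp v g') (S.c k), by
    rw [S.step, hg', expand_gapComp w (gapComp v g')], ?_⟩
  refine List.IsInfix.trans ?_ (infix_gapComp_of_mem _ _ hxk)
  obtain ⟨s, hs⟩ := gapComp_eq_append_self v g'
  obtain ⟨t, ht⟩ := gapComp_eq_append v g'
  nth_rewrite 1 [hs]
  rw [ht]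
  exact ⟨s, t, by simp⟩

lemma gaps_nonempty (n : ℕ) : (S.gaps n).Nonempty := by
  obtain ⟨x, hx⟩ := List.exists_mem_of_ne_nil _ (S.c_ne_nil n)
  exact ⟨x, n, le_rfl, hx⟩

lemma gaps_anti {m n : ℕ} (h : m ≤ n) : S.gaps n ⊆ S.gaps m :=
  fun _ ⟨k, hk, hx⟩ => ⟨k, h.trans hk, hx⟩

lemma exists_cons_mem_gapLang {w : List (Fin 2)} {g : List ℕ} (hg : g ∈ S.gapLang w) :
    ∃ x, x :: g ∈ S.gapLang w := by
  obtain ⟨m, g', hm, s, t, rfl⟩ := hg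
  obtain ⟨x, hx⟩ := S.gaps_nonempty m
  have h := S.append_gap_append_mem hm hx
  have h2 : ∃ l y, (s ++ g ++ t) ++ x :: s = l ++ [y] :=
    ⟨_, _, (List.dropLast_append_getLast (by simp)).symm⟩
  obtain ⟨l, y, hl⟩ := h2
  refine ⟨y, S.gapLang_of_infix ⟨l, t, ?_⟩ h⟩
  calc l ++ y :: g ++ t = (l ++ [y]) ++ (g ++ t) := by simp
    _ = _ := by rw [← hl]; simp

lemma mem_of_mem_gapLang {G : Set ℕ} {w : List (Fin 2)} (hw : S.IsBlock G w) {g : List ℕ}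
    (hg : g ∈ S.gapLang w) {x : ℕ} (hx : x ∈ g) : x ∈ G := by
  obtain ⟨h0, M, hM⟩ := hw
  obtain ⟨m, g', hm, hi⟩ := hg
  obtain ⟨g2, h2⟩ := S.P_eq_expand_gapComp hm (max m M) (le_max_left _ _)
  obtain ⟨g3, h3, h4⟩ := hM (max m M) (le_max_right _ _)
  have := expand_injective h0 (h2.symm.trans h3)
  exact h4 x (this ▸ (mem_gapComp _ _).2 (Or.inl (hi.subset hx)))

lemma _root_.expand_infix (w : List (Fin 2)) {g g' : List ℕ} (h : g <:+: g') :
    expand w g <:+: expand w g' := by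
  obtain ⟨s, t, rfl⟩ := h
  have h1 : expand w (s ++ g) <:+: expand w (s ++ g ++ t) := by
    cases t with
    | nil => simp
    | cons y t => rw [expand_append_cons, List.append_assoc]; exact (List.prefix_append _ _).isInfix
  refine List.IsInfix.trans ?_ h1
  rcases List.eq_nil_or_concat s with rfl | ⟨s', x, rfl⟩
  · simp
  · rw [List.concat_eq_append, List.append_assoc, List.singleton_append, expand_append_cons]
    exact (List.suffix_append _ _).isInfix

lemma expand_mem_lang {w : List (Fin 2)} {g : List ℕ} (hg : g ∈ S.gapLang w) :
    expand w g ∈ S.lang := by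
  obtain ⟨m, g', hm, hi⟩ := hg
  exact ⟨m, hm ▸ expand_infix w hi⟩

lemma RightSpecial.of_suffix {S : RankOneWords} {u v : List (Fin 2)} (h : u <:+ v)
    (hv : S.RightSpecial v) : S.RightSpecial u := by
  obtain ⟨t, rfl⟩ := h
  exact ⟨S.lang_of_infix ⟨t, [], by simp⟩ hv.1, S.lang_of_infix ⟨t, [], by simp⟩ hv.2⟩

/-- After `x` letters `1`, the gap `x` is followed by the `0` that starts `w`, the longer gap `y` by
another `1`. -/
lemma rightSpecial_expand {w : List (Fin 2)} (hw : ZeroEnded w) {g : List ℕ} {x y : ℕ}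
    (hxy : x < y) (hx : g ++ [x] ∈ S.gapLang w) (hy : g ++ [y] ∈ S.gapLang w) :
    S.RightSpecial (expand w g ++ List.replicate x 1) := by
  obtain ⟨⟨t, ht⟩, -⟩ := hw
  have h1 := S.expand_mem_lang hx
  have h2 := S.expand_mem_lang hy
  rw [expand_append_cons] at h1 h2
  constructor
  · refine S.lang_of_infix ⟨[], t, ?_⟩ h1
    simp [expand, ← ht]
  · refine S.lang_of_infix ⟨[], List.replicate (y - x - 1) 1 ++ w, ?_⟩ h2
    obtain ⟨d, rfl⟩ := Nat.exists_eq_add_of_lt hxy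
    simp [expand, List.replicate_add, add_assoc, add_comm d 1]

/-- Every occurrence extends to the left by a gap, which has at least `z` letters `1`. -/
lemma rightSpecial_padded {w : List (Fin 2)} (hw : ZeroEnded w) {g : List ℕ} {x y z : ℕ}
    (hxy : x < y) (hx : g ++ [x] ∈ S.gapLang w) (hy : g ++ [y] ∈ S.gapLang w)
    (hz : ∀ g ∈ S.gapLang w, ∀ c ∈ g, z ≤ c) :
    S.RightSpecial (List.replicate z 1 ++ expand w g ++ List.replicate x 1) := by
  have key : ∀ c, g ++ [c] ∈ S.gapLang w →
      List.replicate z 1 ++ expand w g ++ List.replicate c 1 ++ w ∈ S.lang := by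
    intro c hc
    obtain ⟨d, hd⟩ := S.exists_cons_mem_gapLang hc
    have h1 := S.expand_mem_lang hd
    have hzd := hz _ hd d (by simp)
    obtain ⟨k, rfl⟩ := Nat.exists_eq_add_of_le' hzd
    refine S.lang_of_infix ⟨w ++ List.replicate k 1, [], ?_⟩ h1
    simp only [expand, expand_append_cons, List.replicate_add, List.append_assoc, List.append_nil]
  obtain ⟨⟨t, ht⟩, -⟩ := hw
  constructor
  · refine S.lang_of_infix ⟨[], t, ?_⟩ (key x hx)
    simp [← ht]
  · refine S.lang_of_infix ⟨[], List.replicate (y - x - 1) 1 ++ w, ?_⟩ (key y hy)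
    obtain ⟨d, rfl⟩ := Nat.exists_eq_add_of_lt hxy
    simp [List.replicate_add, add_assoc, add_comm d 1]

/-- There are two right special words of each length in `(α, β]`. -/
def TwoSpecial (α β : ℕ) : Prop :=
  ∀ q, α < q → q ≤ β → ∃ u v, u ≠ v ∧ u.length = q ∧ v.length = q ∧
    S.RightSpecial u ∧ S.RightSpecial v

/-- Suffixes of right special words are right special, and those of `U` and `V` differ as soon as
they reach beyond the common suffix `s`. -/
lemma twoSpecial_of_suffix {U V s : List (Fin 2)} {x y : Fin 2} {β : ℕ} (hU : S.RightSpecial U)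
    (hV : S.RightSpecial V) (hx : x :: s <:+ U) (hy : y :: s <:+ V) (hxy : x ≠ y)
    (hβU : β ≤ U.length) (hβV : β ≤ V.length) : S.TwoSpecial s.length β := by
  intro q hq hqβ
  refine ⟨U.drop (U.length - q), V.drop (V.length - q), ?_, by simp; omega, by simp; omega,
    hU.of_suffix (List.drop_suffix _ _), hV.of_suffix (List.drop_suffix _ _)⟩
  intro h
  have h1 : x :: s <:+ U.drop (U.length - q) :=
    List.suffix_of_suffix_length_le hx (List.drop_suffix _ _) (by simp; omega)
  have h2 : y :: s <:+ U.drop (U.length - q) := h ▸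
    List.suffix_of_suffix_length_le hy (List.drop_suffix _ _) (by simp; omega)
  have h3 := List.suffix_of_suffix_length_le h1 h2 (by simp)
  have h4 := h3.eq_of_length (by simp)
  simp only [List.cons.injEq] at h4
  exact hxy h4.1

/-- Three gaps at a stage yield two right special words. -/
lemma twoSpecial_of_three_gaps (n : ℕ) {a b c : ℕ} (ha : a ∈ S.gaps n) (hb : b ∈ S.gaps n)
    (hc : c ∈ S.gaps n) (hab : a < b) (hbc : b < c) :
    S.TwoSpecial a ((S.P n).length + a) := by
  have key : ∀ {x}, x ∈ S.gaps n → [] ++ [x] ∈ S.gapLang (S.P n) := fun hx =>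
    S.append_gap_append_mem (v := []) rfl hx
  have h0 := S.zeroEnded_P n
  have h1 := S.rightSpecial_expand h0 hab (key ha) (key hb)
  have h2 := S.rightSpecial_expand h0 hbc (key hb) (key hc)
  simp only [expand] at h1 h2
  -- The block ends with `0`, so the two words end with `0 1^a` and `1 1^a`.
  have h3 := S.twoSpecial_of_suffix (s := List.replicate a 1) (x := 0) (y := 1)
    (β := (S.P n).length + a) h1 h2 ?_ ?_ (by decide) (by simp) (by simp; omega)
  · simpa using h3
  · obtain ⟨-, t, ht⟩ := h0
    exact ⟨t, by simp [ht]⟩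
  · obtain ⟨d, rfl⟩ := Nat.exists_eq_add_of_lt hab
    refine ⟨S.P n ++ List.replicate d 1, ?_⟩
    rw [show a + d + 1 = d + (a + 1) by omega, List.replicate_add, List.replicate_succ]
    simp

end RankOneWords

/-! ### Two recurring gaps: combinatorics of gap words over two letters. -/

lemma exists_replicate_append_cons {e f : ℕ} {v : List ℕ} (hv : ∀ x ∈ v, x = e ∨ x = f)
    (he : e ∈ v) : ∃ s g, v = List.replicate s f ++ e :: g := by
  induction v with
  | nil => simp at he
  | cons y v ih =>
    by_cases hy : y = e
    · exact ⟨0, v, by simp [hy]⟩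
    · have hyf : y = f := (hv y (by simp)).resolve_left hy
      obtain ⟨s, g, h⟩ := ih (fun x hx => hv x (by simp [hx])) (by
        rcases List.mem_cons.1 he with h | h
        · exact absurd h.symm hy
        · exact h)
      exact ⟨s + 1, g, by rw [h, hyf]; simp [List.replicate_succ]⟩

lemma exists_append_cons_replicate {e f : ℕ} {v : List ℕ} (hv : ∀ x ∈ v, x = e ∨ x = f)
    (he : e ∈ v) : ∃ t g, v = g ++ e :: List.replicate t f := by
  obtain ⟨t, g, h⟩ := exists_replicate_append_cons (v := v.reverse) (e := e) (f := f)
    (by simpa using hv) (by simpa using he)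
  refine ⟨t, g.reverse, ?_⟩
  have := congrArg List.reverse h
  simpa using this

namespace RankOneWords

variable (S : RankOneWords)

/-- Transfers right special gap words with common suffix `r`, preceded by different letters, to
binary words. The two terms `a` come from the shorter gap being a common part of both gaps, before
and after `r`. -/
lemma twoSpecial_of_gapLang {w : List (Fin 2)} (hw : ZeroEnded w) {a b : ℕ} (hab : a < b)
    (hz : ∀ g ∈ S.gapLang w, ∀ c ∈ g, a ≤ c) {e f : ℕ} (hef : e = a ∧ f = b ∨ e = b ∧ f = a)
    {l l' r : List ℕ} {β : ℕ}
    (h1 : ∀ x, x = e ∨ x = f → (l ++ e :: r) ++ [x] ∈ S.gapLang w)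
    (h2 : ∀ x, x = e ∨ x = f → (l' ++ f :: r) ++ [x] ∈ S.gapLang w)
    (hβ : β ≤ 2 * a + (expand w (l ++ e :: r)).length)
    (hβ' : β ≤ 2 * a + (expand w (l' ++ f :: r)).length) :
    S.TwoSpecial (2 * a + (expand w r).length) β := by
  wlog h : e = a ∧ f = b generalizing e f l l'
  · have h' := hef.resolve_left h
    exact this (e := f) (f := e) (Or.inl h'.symm) (fun x hx => h2 x hx.symm)
      (fun x hx => h1 x hx.symm) hβ' hβ h'.symm
  obtain ⟨rfl, rfl⟩ := h
  have hU := S.rightSpecial_padded hw hab (h1 e (Or.inl rfl)) (h1 f (Or.inr rfl)) hz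
  have hV := S.rightSpecial_padded hw hab (h2 e (Or.inl rfl)) (h2 f (Or.inr rfl)) hz
  -- To the left of the common suffix, the gap `a` is exhausted and a copy of `w` ends with `0`,
  -- while the longer gap `b` still supplies a `1`.
  have key := S.twoSpecial_of_suffix (x := 0) (y := 1) (β := β)
    (s := List.replicate e 1 ++ expand w r ++ List.replicate e 1) hU hV ?_ ?_ (by decide)
    (by simp only [List.length_append, List.length_replicate]; omega)
    (by simp only [List.length_append, List.length_replicate]; omega)
  · have h3 : (List.replicate e 1 ++ expand w r ++ List.replicate e 1).length =
        2 * e + (expand w r).length := by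
      simp only [List.length_append, List.length_replicate]; omega
    rwa [h3] at key
  · obtain ⟨-, t, ht⟩ := hw.expand l
    refine ⟨List.replicate e 1 ++ t, ?_⟩
    rw [expand_append_cons, ht]
    simp
  · obtain ⟨d, rfl⟩ := Nat.exists_eq_add_of_lt hab
    refine ⟨List.replicate e 1 ++ expand w l' ++ List.replicate d 1, ?_⟩
    rw [expand_append_cons, show e + d + 1 = d + (e + 1) by omega, List.replicate_add,
      List.replicate_succ]
    simp

/-- If all `f`-runs between two letters `e` have length at least `k`, then every letter `e` is
preceded by `k` letters `f`. -/
lemma replicate_append_mem_gapLang {w : List (Fin 2)} {e f k : ℕ}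
    (hef : ∀ g ∈ S.gapLang w, ∀ x ∈ g, x = e ∨ x = f)
    (hk : ∀ j, e :: List.replicate j f ++ [e] ∈ S.gapLang w → k ≤ j)
    {g : List ℕ} (hg : e :: g ∈ S.gapLang w) :
    List.replicate k f ++ e :: g ∈ S.gapLang w := by
  have : ∀ i ≤ k, List.replicate i f ++ e :: g ∈ S.gapLang w := by
    intro i
    induction i with
    | zero => simpa using hg
    | succ i ih =>
      intro hi
      obtain ⟨x, hx⟩ := S.exists_cons_mem_gapLang (ih (by omega))
      rcases hef _ hx x (by simp) with rfl | rfl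
      · have := hk i (S.gapLang_of_infix ⟨[], g, by simp⟩ hx)
        omega
      · simpa [List.replicate_succ] using hx
  exact this k le_rfl

/-- Since `f^(2k+1) = f^k f f^k`, a run of either length splits into blocks `f^k` separated by
single letters. -/
lemma eq_gapComp_of_runs {w : List (Fin 2)} {e f k : ℕ}
    (hef : ∀ g ∈ S.gapLang w, ∀ x ∈ g, x = e ∨ x = f)
    (hk : ∀ j, e :: List.replicate j f ++ [e] ∈ S.gapLang w → j = k ∨ j = 2 * k + 1)
    (g : List ℕ) (hg : e :: g ++ [e] ∈ S.gapLang w) :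
    ∃ u, g = gapComp (List.replicate k f) u := by
  induction hn : g.length using Nat.strong_induction_on generalizing g with
  | _ n ih =>
    have hlet : ∀ x ∈ g, x = e ∨ x = f := fun x hx => hef _ hg x (by simp [hx])
    have htwo : List.replicate (2 * k + 1) f = List.replicate k f ++ f :: List.replicate k f := by
      rw [show 2 * k + 1 = k + (k + 1) by omega, List.replicate_add, List.replicate_succ]
    by_cases he : e ∈ g
    · obtain ⟨s, g', rfl⟩ := exists_replicate_append_cons hlet he
      obtain ⟨u, rfl⟩ := ih g'.length (by simp at hn; omega) g'
        (S.gapLang_of_infix ⟨e :: List.replicate s f, [], by simp⟩ hg) rfl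
      rcases hk s (S.gapLang_of_infix ⟨[], gapComp (List.replicate k f) u ++ [e], by simp⟩ hg)
        with rfl | rfl
      · exact ⟨e :: u, by simp [gapComp]⟩
      · exact ⟨f :: e :: u, by simp [gapComp, htwo]⟩
    · have hrep : g = List.replicate g.length f :=
        List.eq_replicate_of_mem fun x hx => (hlet x hx).resolve_left fun h => he (h ▸ hx)
      rw [hrep] at hg
      rcases hk _ hg with h | h
      · exact ⟨[], by rw [hrep, h, gapComp]⟩
      · exact ⟨[f], by rw [hrep, h, gapComp, gapComp, htwo]⟩

/-- With `s` and `t` the lengths of the initial and final `f`-runs of `v`, all claims are read off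
from `v e v`, except the last, where `v f v` merges the two runs. -/
lemma exists_runs {w : List (Fin 2)} {e f : ℕ} {m : ℕ} {v : List ℕ}
    (hv : S.P m = expand w v) (hvef : ∀ x ∈ v, x = e ∨ x = f) (hev : e ∈ v)
    (he : e ∈ S.gaps m) (hf : f ∈ S.gaps m) :
    ∃ s t g, v = List.replicate s f ++ e :: g ∧ e :: g ++ [e] ∈ S.gapLang w ∧
      e :: List.replicate s f ++ [e] ∈ S.gapLang w ∧
      e :: List.replicate t f ++ [e] ∈ S.gapLang w ∧
      e :: List.replicate (s + t + 1) f ++ [e] ∈ S.gapLang w := by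
  obtain ⟨s, g, hs⟩ := exists_replicate_append_cons hvef hev
  obtain ⟨t, g', ht⟩ := exists_append_cons_replicate hvef hev
  have h1 := S.append_gap_append_mem hv he
  have h2 := S.append_gap_append_mem hv hf
  refine ⟨s, t, g, hs, ?_, ?_, ?_, ?_⟩
  · refine S.gapLang_of_infix ⟨List.replicate s f, v, ?_⟩ h1
    nth_rewrite 2 [hs]; simp
  · refine S.gapLang_of_infix ⟨v, g, ?_⟩ h1
    nth_rewrite 3 [hs]; simp
  · refine S.gapLang_of_infix ⟨g', v, ?_⟩ h1
    nth_rewrite 2 [ht]; simp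
  · refine S.gapLang_of_infix ⟨g', g, ?_⟩ h2
    nth_rewrite 2 [hs]; rw [ht]
    rw [show s + t + 1 = t + (s + 1) by omega, List.replicate_add, List.replicate_succ]
    simp

lemma exists_gapLang_letter {G : Set ℕ} {w : List (Fin 2)} (hw : S.IsBlock G w) {e : ℕ}
    (he : ∀ n, e ∈ S.gaps n) : ∃ M, ∀ m, M ≤ m → ∃ v, S.P m = expand w v ∧ e ∈ v ∧
      ∀ x ∈ v, x ∈ G := by
  obtain ⟨h0, M, hM⟩ := hw
  obtain ⟨k, hk, hek⟩ := he M
  obtain ⟨v, hv, -⟩ := hM k hk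
  refine ⟨k + 1, fun m hm => ?_⟩
  have h1 : S.P (k + 1) = expand w (gapComp v (S.c k)) := by
    rw [S.step, hv, expand_gapComp]
  obtain ⟨g, hg⟩ := S.P_eq_expand_gapComp h1 m hm
  obtain ⟨g', hg', hG⟩ := hM m (by omega)
  have := expand_injective h0 (hg.symm.trans hg')
  exact ⟨_, hg, (mem_gapComp _ _).2 (Or.inl ((mem_gapComp _ _).2 (Or.inr hek))), this ▸ hG⟩

/-- The case in which the gap `e` is isolated. -/
lemma twoSpecial_of_isolated {w : List (Fin 2)} {a b : ℕ} (hab : a < b)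
    (hw : S.IsBlock {a, b} w) (ha : ∀ n, a ∈ S.gaps n) (hb : ∀ n, b ∈ S.gaps n) {e f : ℕ}
    (hef : e = a ∧ f = b ∨ e = b ∧ f = a) (hee : [e, e] ∉ S.gapLang w) :
    (∃ α β, w.length ≤ α ∧ 2 * α ≤ β + 2 * a ∧ S.TwoSpecial α β) ∨
    ∃ Q, S.IsBlock {a, b} Q ∧ 2 * w.length ≤ Q.length ∧
      S.TwoSpecial (2 * a + Q.length) (2 * a + (2 * Q.length - w.length)) := by
  have hset : ∀ x, x ∈ ({a, b} : Set ℕ) ↔ x = e ∨ x = f := by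
    rcases hef with ⟨rfl, rfl⟩ | ⟨rfl, rfl⟩ <;> intro x <;> simp [or_comm]
  have hlet : ∀ g ∈ S.gapLang w, ∀ x ∈ g, x = e ∨ x = f := fun g hg x hx =>
    (hset x).1 (S.mem_of_mem_gapLang hw hg hx)
  have hz : ∀ g ∈ S.gapLang w, ∀ c ∈ g, a ≤ c := by
    intro g hg c hc
    rcases S.mem_of_mem_gapLang hw hg hc with rfl | rfl
    · exact le_rfl
    · exact hab.le
  have he : ∀ n, e ∈ S.gaps n := by rcases hef with ⟨rfl, rfl⟩ | ⟨rfl, rfl⟩ <;> assumption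
  have hf : ∀ n, f ∈ S.gaps n := by rcases hef with ⟨rfl, rfl⟩ | ⟨rfl, rfl⟩ <;> assumption
  obtain ⟨M, hM⟩ := S.exists_gapLang_letter hw he
  have hruns : ∀ m, M ≤ m → ∃ s t g, S.P m = expand w (List.replicate s f ++ e :: g) ∧
      (∀ x ∈ g, x = e ∨ x = f) ∧ e :: g ++ [e] ∈ S.gapLang w ∧
      e :: List.replicate s f ++ [e] ∈ S.gapLang w ∧
      e :: List.replicate t f ++ [e] ∈ S.gapLang w ∧
      e :: List.replicate (s + t + 1) f ++ [e] ∈ S.gapLang w := by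
    intro m hm
    obtain ⟨v, hv, hev, hG⟩ := hM m hm
    have hG' : ∀ x ∈ v, x = e ∨ x = f := fun x hx => (hset x).1 (hG x hx)
    obtain ⟨s, t, g, h1, h2⟩ := S.exists_runs hv hG' hev (he m) (hf m)
    exact ⟨s, t, g, h1 ▸ hv, fun x hx => hG' x (by rw [h1]; simp [hx]), h2⟩
  set K : ℕ → Prop := fun j => e :: List.replicate j f ++ [e] ∈ S.gapLang w with hK
  have hK0 : ¬ K 0 := by simpa [hK] using hee
  have hex : ∃ j, K j := by
    obtain ⟨s, t, g, -, -, -, h, -⟩ := hruns M le_rfl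
    exact ⟨s, h⟩
  classical
  -- The shortest run of `f` between two letters `e`; it is nonempty because `e e` does not occur.
  obtain ⟨k, hKk, hmin⟩ : ∃ k, K k ∧ ∀ j, K j → k ≤ j :=
    ⟨Nat.find hex, Nat.find_spec hex, fun j hj => Nat.find_min' hex hj⟩
  have hk1 : 1 ≤ k := Nat.one_le_iff_ne_zero.2 fun h => hK0 (h ▸ hKk)
  -- a run is preceded by `k` letters `f`, and its prefixes are continued by `f`
  have hend : ∀ j, K j → List.replicate k f ++ e :: List.replicate j f ++ [e] ∈ S.gapLang w := by
    intro j hj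
    have := S.replicate_append_mem_gapLang hlet hmin (g := List.replicate j f ++ [e])
      (by simpa [hK] using hj)
    simpa using this
  have hcont : ∀ i j, i < j → K j →
      List.replicate k f ++ e :: List.replicate i f ++ [f] ∈ S.gapLang w := by
    intro i j hij hj
    refine S.gapLang_of_infix ⟨[], List.replicate (j - i - 1) f ++ [e], ?_⟩ (hend j hj)
    obtain ⟨d, rfl⟩ := Nat.exists_eq_add_of_lt hij
    rw [show i + d + 1 = i + (d + 1) by omega, List.replicate_add, List.replicate_succ,
      show i + (d + 1) - i - 1 = d by omega]
    simp
  have hkk : ∀ j, k < j → K j → ∀ x, x = e ∨ x = f →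
      (List.replicate k f ++ e :: List.replicate k f) ++ [x] ∈ S.gapLang w := by
    rintro j hkj hj x (rfl | rfl)
    · exact hend k hKk
    · exact hcont k j hkj hj
  have hrep : ∀ i, k < i → List.replicate i f =
      List.replicate (i - k - 1) f ++ f :: List.replicate k f := by
    intro i hi
    obtain ⟨d, rfl⟩ := Nat.exists_eq_add_of_lt hi
    rw [show k + d + 1 = d + (k + 1) by omega, List.replicate_add, List.replicate_succ,
      show d + (k + 1) - k - 1 = d by omega]
  have hlong : ∀ i j, i < j → K j → ∀ x, x = e ∨ x = f →
      List.replicate i f ++ [x] ∈ S.gapLang w := by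
    rintro i j hij hj x (rfl | rfl)
    · refine S.gapLang_of_infix ⟨x :: List.replicate (j - i) f, [], ?_⟩ hj
      obtain ⟨d, rfl⟩ := Nat.exists_eq_add_of_lt hij
      rw [show i + d + 1 = (d + 1) + i by omega, List.replicate_add (d + 1) i,
        show d + 1 + i - i = d + 1 by omega]
      simp only [List.cons_append, List.append_assoc, List.append_nil]
    · exact S.gapLang_of_infix ⟨List.replicate k x ++ [e], [], by simp⟩ (hcont i j hij hj)
  have h0 := hw.1
  have hpos := h0.length_pos
  set h := w.length with hh
  have hlen : ∀ j, (expand w (List.replicate j f)).length = (j + 1) * h + j * f := by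
    intro j; rw [length_expand]; simp [hh]
  -- In such a run `f^k f f^k` is followed by both letters, and so is `f^k e f^k`. With common
  -- suffix `f^k` this is the first alternative.
  by_cases hbig : ∃ j, K j ∧ 2 * k + 2 ≤ j
  · obtain ⟨j, hj, hkj⟩ := hbig
    left
    refine ⟨2 * a + (expand w (List.replicate k f)).length,
      2 * a + 2 * (expand w (List.replicate k f)).length, ?_, by omega,
      S.twoSpecial_of_gapLang h0 hab hz hef (l := List.replicate k f) (l' := List.replicate k f)
        (hkk j (by omega) hj) ?_ ?_ ?_⟩
    · rw [hlen]; nlinarith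
    · have := hlong (2 * k + 1) j (by omega) hj
      rw [hrep (2 * k + 1) (by omega), show 2 * k + 1 - k - 1 = k by omega] at this
      exact this
    · rw [expand_append_cons]; simp only [List.length_append]; omega
    · rw [expand_append_cons]; simp only [List.length_append]; omega
  -- Here `f^k e f^i` is followed by `e` in the run of length `i` and by `f` in that of length `j`.
  -- It ends with `f f^k`, and is again compared with `f^k e f^k`.
  by_cases hthree : ∃ i j, K i ∧ K j ∧ k < i ∧ i < j
  · obtain ⟨i, j, hi, hj, hki, hij⟩ := hthree
    left
    have heq : List.replicate k f ++ e :: List.replicate i f =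
        (List.replicate k f ++ e :: List.replicate (i - k - 1) f) ++ f :: List.replicate k f := by
      rw [hrep i hki]; simp
    refine ⟨2 * a + (expand w (List.replicate k f)).length,
      2 * a + 2 * (expand w (List.replicate k f)).length, ?_, by omega,
      S.twoSpecial_of_gapLang h0 hab hz hef (l := List.replicate k f)
        (l' := List.replicate k f ++ e :: List.replicate (i - k - 1) f)
        (hkk j (by omega) hj) ?_ ?_ ?_⟩
    · rw [hlen]; nlinarith
    · rw [← heq]
      rintro x (rfl | rfl)
      · exact hend i hi
      · exact hcont i j hij hj
    · rw [expand_append_cons]; simp only [List.length_append]; omega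
    · rw [expand_append_cons, expand_append_cons]; simp only [List.length_append]; omega
  right
  push Not at hbig hthree
  -- At most one run length exceeds `k`, and `s + t + 1` is one, so `s` and `t` both equal `k`.
  have hkall : ∀ s t, K s → K t → K (s + t + 1) → s = k ∧ K (2 * k + 1) := by
    intro s t hs ht hst
    have h1 := hmin s hs
    have h2 := hmin t ht
    have h3 := hthree s (s + t + 1) hs hst
    have h4 := hthree t (s + t + 1) ht hst
    obtain rfl : s = k := by omega
    obtain rfl : t = s := by omega
    exact ⟨rfl, by rwa [show 2 * t + 1 = t + t + 1 by omega]⟩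
  have h2k : K (2 * k + 1) := by
    obtain ⟨s, t, g, -, -, -, h1, h2, h3⟩ := hruns M le_rfl
    exact (hkall s t h1 h2 h3).2
  have hKall : ∀ j, K j → j = k ∨ j = 2 * k + 1 := by
    intro j hj
    have h1 := hmin j hj
    have h2 := hthree j (2 * k + 1) hj h2k
    have h3 := hbig j hj
    omega
  refine ⟨expand w (List.replicate k f), ⟨h0.expand _, M, fun m hm => ?_⟩, ?_, ?_⟩
  · obtain ⟨s, t, g, h1, h2, h3, h4, h5, h6⟩ := hruns m hm
    obtain ⟨rfl, -⟩ := hkall s t h4 h5 h6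
    obtain ⟨u, rfl⟩ := S.eq_gapComp_of_runs hlet hKall g h3
    refine ⟨e :: u, ?_, ?_⟩
    · rw [h1, ← expand_gapComp, gapComp]
    · intro x hx
      rw [hset]
      rcases List.mem_cons.1 hx with rfl | hx
      · exact Or.inl rfl
      · exact h2 x ((mem_gapComp _ _).2 (Or.inr hx))
  · rw [hlen]; nlinarith
  -- The gap words are `f^k e f^k` and `f^(2k) = f^(k-1) f f^k`, the longest power of `f` followed
  -- by both letters. The latter expands to two copies of `Q` overlapping in one `w`, which explains
  -- the length `2|Q| - |w|`.
  · refine S.twoSpecial_of_gapLang h0 hab hz hef (l := List.replicate k f)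
      (l' := List.replicate (k - 1) f) (hkk _ (by omega) h2k) ?_ ?_ ?_
    · have := hlong (2 * k) _ (by omega) h2k
      rw [hrep (2 * k) (by omega), show 2 * k - k - 1 = k - 1 by omega] at this
      exact this
    · rw [expand_append_cons]; simp only [List.length_append]; omega
    · rw [show k - 1 = 2 * k - k - 1 by omega, ← hrep (2 * k) (by omega), hlen, hlen]
      have : 2 * ((k + 1) * h + k * f) - h = (2 * k + 1) * h + 2 * k * f := by
        rw [Nat.sub_eq_iff_eq_add (by nlinarith)]; ring
      omega

/-- Every word from which a rank-one sequence with exactly two recurring gaps is built gives rise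
to two right special words of many lengths, or to a longer such word. -/
theorem twoSpecial_of_two_gaps {w : List (Fin 2)} {a b : ℕ} (hab : a < b)
    (hw : S.IsBlock {a, b} w) (ha : ∀ n, a ∈ S.gaps n) (hb : ∀ n, b ∈ S.gaps n) :
    (∃ α β, w.length ≤ α ∧ 2 * α ≤ β + 2 * a ∧ S.TwoSpecial α β) ∨
    ∃ Q, S.IsBlock {a, b} Q ∧ 2 * w.length ≤ Q.length ∧
      S.TwoSpecial (2 * a + Q.length) (2 * a + (2 * Q.length - w.length)) := by
  by_cases haa : [a, a] ∈ S.gapLang w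
  swap
  · exact S.twoSpecial_of_isolated hab hw ha hb (Or.inl ⟨rfl, rfl⟩) haa
  by_cases hbb : [b, b] ∈ S.gapLang w
  swap
  · exact S.twoSpecial_of_isolated hab hw ha hb (Or.inr ⟨rfl, rfl⟩) hbb
  left
  obtain ⟨M, hM⟩ := S.exists_gapLang_letter hw hb
  obtain ⟨v, hv, hbv, hG⟩ := hM M le_rfl
  obtain ⟨s, t, g, -, -, -, -, hst⟩ := S.exists_runs hv (e := b) (f := a)
    (fun x hx => (hG x hx).symm) hbv (hb M) (ha M)
  have h1 : [b, a] ∈ S.gapLang w := S.gapLang_of_infix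
    ⟨[], List.replicate (s + t) a ++ [b], by simp [List.replicate_succ]⟩ hst
  have h2 : [a, b] ∈ S.gapLang w := S.gapLang_of_infix
    ⟨b :: List.replicate (s + t) a, [], by simp [List.replicate_succ']⟩ hst
  have hz : ∀ g ∈ S.gapLang w, ∀ c ∈ g, a ≤ c := by
    intro g hg c hc
    rcases S.mem_of_mem_gapLang hw hg hc with rfl | rfl
    · exact le_rfl
    · exact hab.le
  -- All four two-letter gap words occur, so the single gaps `a` and `b` are each followed by both
  -- letters and the common suffix is empty.
  refine ⟨2 * a + w.length, 2 * a + 2 * w.length, by omega, by omega,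
    S.twoSpecial_of_gapLang hw.1 hab hz (Or.inl ⟨rfl, rfl⟩) (l := []) (l' := []) (r := [])
      ?_ ?_ ?_ ?_⟩
  · rintro x (rfl | rfl) <;> assumption
  · rintro x (rfl | rfl) <;> assumption
  · simp [length_expand]
  · simp [length_expand]

end RankOneWords

/-! ### Counting words: growth of the complexity. -/

namespace RankOneWords

variable (S : RankOneWords)

/-- The number of words of length `q` in the language. -/
noncomputable def complexity (q : ℕ) : ℕ := Set.ncard {u | u ∈ S.lang ∧ u.length = q}

lemma finite_lang_length (q : ℕ) : {u | u ∈ S.lang ∧ u.length = q}.Finite :=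
  (List.finite_length_eq (Fin 2) q).subset fun _ h => h.2

lemma P_succ (n : ℕ) : ∃ x t, S.P (n + 1) = S.P n ++ List.replicate x 1 ++ S.P n ++ t := by
  obtain ⟨x, l, hl⟩ := List.exists_cons_of_ne_nil (S.c_ne_nil n)
  cases l with
  | nil => exact ⟨x, [], by simp [S.step, hl, expand]⟩
  | cons y l =>
    exact ⟨x, List.replicate y 1 ++ expand (S.P n) l, by simp [S.step, hl, expand]⟩

lemma exists_append_mem_lang {u : List (Fin 2)} (hu : u ∈ S.lang) : ∃ x, u ++ [x] ∈ S.lang := by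
  obtain ⟨m, s, t, hm⟩ := hu
  obtain ⟨c, t', h⟩ := S.P_succ m
  obtain ⟨⟨r, hr⟩, -⟩ := S.zeroEnded_P m
  obtain ⟨x, l, hx⟩ : ∃ x l, t ++ List.replicate c 1 ++ S.P m ++ t' = x :: l :=
    List.exists_cons_of_ne_nil (by simp [hr])
  refine ⟨x, m + 1, s, l, ?_⟩
  rw [h]
  nth_rewrite 1 [← hm]
  calc s ++ (u ++ [x]) ++ l = s ++ u ++ (x :: l) := by simp
    _ = _ := by rw [← hx]; simp

lemma exists_cons_mem_lang {u : List (Fin 2)} (hu : u ∈ S.lang) : ∃ x, x :: u ∈ S.lang := by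
  obtain ⟨m, s, t, hm⟩ := hu
  obtain ⟨c, t', h⟩ := S.P_succ m
  obtain ⟨⟨r, hr⟩, -⟩ := S.zeroEnded_P m
  obtain ⟨l, x, hx⟩ : ∃ l x, S.P m ++ List.replicate c 1 ++ s = l ++ [x] :=
    ⟨_, _, (List.dropLast_append_getLast (by simp [hr])).symm⟩
  refine ⟨x, m + 1, l, t ++ t', ?_⟩
  rw [h]
  nth_rewrite 2 [← hm]
  calc l ++ x :: u ++ (t ++ t') = (l ++ [x]) ++ u ++ t ++ t' := by simp
    _ = _ := by rw [← hx]; simp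

/-- Each word of length `q` has a chosen extension `e u`; a right special word has the other
extension `1 - e u` as well. -/
lemma complexity_add_ncard_le {q : ℕ} {A : Set (List (Fin 2))}
    (hA : ∀ u ∈ A, u.length = q ∧ S.RightSpecial u) :
    S.complexity q + A.ncard ≤ S.complexity (q + 1) := by
  have hmem : ∀ u ∈ A, u ∈ S.lang := fun u hu => S.lang_of_infix ⟨[], [0], by simp⟩ (hA u hu).2.1
  have hAf : A.Finite := (S.finite_lang_length q).subset fun u hu => ⟨hmem u hu, (hA u hu).1⟩
  choose! e he using fun (u : List (Fin 2)) (hu : u ∈ S.lang) => S.exists_append_mem_lang hu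
  have h1 : ((fun u => u ++ [e u]) '' {u | u ∈ S.lang ∧ u.length = q}).ncard = S.complexity q := by
    refine Set.ncard_image_of_injective _ fun u v h => ?_
    exact (List.append_inj' h rfl).1
  have h2 : ((fun u => u ++ [1 - e u]) '' A).ncard = A.ncard := by
    refine Set.ncard_image_of_injective _ fun u v h => ?_
    exact (List.append_inj' h rfl).1
  have hdisj : Disjoint ((fun u => u ++ [e u]) '' {u | u ∈ S.lang ∧ u.length = q})
      ((fun u => u ++ [1 - e u]) '' A) := by
    rw [Set.disjoint_left]
    rintro _ ⟨u, -, rfl⟩ ⟨v, -, h⟩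
    obtain ⟨rfl, h⟩ := List.append_inj' h rfl
    simp only [List.cons.injEq, and_true] at h
    revert h; generalize e v = x; revert x; decide
  rw [← h1, ← h2, ← Set.ncard_union_eq hdisj ((S.finite_lang_length q).image _) (hAf.image _)]
  refine Set.ncard_le_ncard ?_ (S.finite_lang_length (q + 1))
  rintro _ (⟨u, ⟨hu, rfl⟩, rfl⟩ | ⟨u, hu, rfl⟩)
  · exact ⟨he u hu, by simp⟩
  · refine ⟨?_, by simp [(hA u hu).1]⟩
    obtain ⟨-, h0, h1⟩ := hA u hu
    rcases (by decide : ∀ x : Fin 2, 1 - x = 0 ∨ 1 - x = 1) (e u) with h | h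
    · simpa only [h] using h0
    · simpa only [h] using h1

lemma length_P_succ (n : ℕ) :
    (S.P (n + 1)).length = ((S.c n).length + 1) * (S.P n).length + (S.c n).sum := by
  rw [S.step, length_expand]

lemma lt_length_P (n : ℕ) : n < (S.P n).length := by
  induction n with
  | zero => exact S.zeroEnded.length_pos
  | succ n ih =>
    rw [S.length_P_succ]
    have h := List.length_pos_of_ne_nil (S.c_ne_nil n)
    have := Nat.mul_le_mul_right (S.P n).length (show 2 ≤ (S.c n).length + 1 by omega)
    omega

/-- The gaps do not become constant. -/
def Nonconstant : Prop := ∀ n, ∃ x ∈ S.gaps n, ∃ y ∈ S.gaps n, x < y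

variable {S}

lemma Nonconstant.complexity_succ (hS : S.Nonconstant) (q : ℕ) :
    S.complexity q + 1 ≤ S.complexity (q + 1) := by
  obtain ⟨x, hx, y, hy, hxy⟩ := hS q
  have h := S.rightSpecial_expand (S.zeroEnded_P q) hxy (g := [])
    (S.append_gap_append_mem (v := []) rfl hx) (S.append_gap_append_mem (v := []) rfl hy)
  have hq := S.lt_length_P q
  set u := expand (S.P q) [] ++ List.replicate x 1 with hu
  have hlen : q ≤ u.length := by rw [hu]; simp [expand]; omega
  have := S.complexity_add_ncard_le (q := q) (A := {u.drop (u.length - q)}) (by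
    rintro v rfl
    exact ⟨by rw [List.length_drop]; omega, h.of_suffix (List.drop_suffix _ _)⟩)
  simpa using this

lemma Nonconstant.complexity_mono (hS : S.Nonconstant) {q q' : ℕ} (h : q ≤ q') :
    S.complexity q + (q' - q) ≤ S.complexity q' := by
  induction q', h using Nat.le_induction with
  | base => simp
  | succ m hm ih => have := hS.complexity_succ m; omega

lemma TwoSpecial.complexity {α β : ℕ} (h : S.TwoSpecial α β) (hαβ : α ≤ β) :
    S.complexity (α + 1) + 2 * (β - α) ≤ S.complexity (β + 1) := by
  have : ∀ q, α ≤ q → q ≤ β → S.complexity (α + 1) + 2 * (q - α) ≤ S.complexity (q + 1) := by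
    intro q hq
    induction q, hq using Nat.le_induction with
    | base => simp
    | succ m hm ih =>
      intro hmβ
      obtain ⟨u, v, huv, hu, hv, hu', hv'⟩ := h (m + 1) (by omega) hmβ
      have := S.complexity_add_ncard_le (q := m + 1) (A := {u, v}) (by
        rintro w (rfl | rfl)
        · exact ⟨hu, hu'⟩
        · exact ⟨hv, hv'⟩)
      rw [Set.ncard_pair huv] at this
      have := ih (by omega)
      omega
  exact this β hαβ le_rfl

/-- If all late gaps exceeded a tenth of the current length, the ratio of that length to the number
of copies would grow exponentially. -/
lemma exists_small_gap {K : ℝ}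
    (hK : ∀ n, ((S.P n).length : ℝ) ≤ K * ∏ m ∈ Finset.range n, (((S.c m).length : ℝ) + 1))
    (N : ℕ) : ∃ n, N ≤ n ∧ ∃ x ∈ S.c n, 10 * x ≤ (S.P n).length := by
  by_contra! hcon
  set R : ℕ → ℝ := fun n => ∏ m ∈ Finset.range n, (((S.c m).length : ℝ) + 1) with hR
  have hRpos : ∀ n, 0 < R n := fun n => Finset.prod_pos fun m _ => by positivity
  -- With `l ≥ 1` gaps the ratio gains a factor of at least `1 + l / (10 (l + 1)) ≥ 21 / 20`.
  have hstep : ∀ n, N ≤ n → 21 / 20 * ((S.P n).length / R n) ≤ (S.P (n + 1)).length / R (n + 1) := by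
    intro n hn
    have h1 : R (n + 1) = R n * (((S.c n).length : ℝ) + 1) := Finset.prod_range_succ _ _
    have h2 : ((S.c n).length : ℝ) * ((S.P n).length / 10) ≤ ((S.c n).sum : ℝ) := by
      have h3 : (S.c n).length • (S.P n).length ≤ ((S.c n).map (10 * ·)).sum := by
        have := List.card_nsmul_le_sum ((S.c n).map (10 * ·)) (S.P n).length (by
          intro y hy
          obtain ⟨x, hx, rfl⟩ := List.mem_map.1 hy
          exact (hcon n hn x hx).le)
        simpa using this
      rw [List.sum_map_mul_left, smul_eq_mul] at h3
      have h4 : ((S.c n).length : ℝ) * (S.P n).length ≤ 10 * ((S.c n).sum : ℝ) := by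
        have : (S.c n).length * (S.P n).length ≤ 10 * (S.c n).sum := by simpa using h3
        exact_mod_cast this
      linarith
    have h5 : (1 : ℝ) ≤ (S.c n).length := by
      exact_mod_cast List.length_pos_of_ne_nil (S.c_ne_nil n)
    have h6 : (0 : ℝ) ≤ (S.P n).length := by positivity
    have h7 : ((S.P (n + 1)).length : ℝ) =
        ((S.c n).length + 1) * (S.P n).length + (S.c n).sum := by
      exact_mod_cast S.length_P_succ n
    rw [h1, h7, le_div_iff₀ (mul_pos (hRpos n) (by positivity))]
    have h8 : 21 / 20 * ((S.P n).length / R n) * (R n * (((S.c n).length : ℝ) + 1)) =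
        21 / 20 * (S.P n).length * (((S.c n).length : ℝ) + 1) := by
      have := (hRpos n).ne'
      field_simp
    rw [h8]
    nlinarith
  have hpow : ∀ k, (21 / 20 : ℝ) ^ k * ((S.P N).length / R N) ≤
      (S.P (N + k)).length / R (N + k) := by
    intro k
    induction k with
    | zero => simp
    | succ k ih =>
      have := hstep (N + k) (by omega)
      rw [← add_assoc, pow_succ]
      linarith
  have hpos : 0 < ((S.P N).length : ℝ) / R N :=
    div_pos (by exact_mod_cast (S.zeroEnded_P N).length_pos) (hRpos N)
  obtain ⟨k, hk⟩ := pow_unbounded_of_one_lt (K / (((S.P N).length : ℝ) / R N))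
    (by norm_num : (1 : ℝ) < 21 / 20)
  rw [div_lt_iff₀ hpos] at hk
  have h1 := hpow k
  have h2 : ((S.P (N + k)).length : ℝ) / R (N + k) ≤ K := (div_le_iff₀ (hRpos _)).2 (hK _)
  linarith

lemma exists_complexity_ge_of_three_gaps
    {K : ℝ} (hK : ∀ n, ((S.P n).length : ℝ) ≤
      K * ∏ m ∈ Finset.range n, (((S.c m).length : ℝ) + 1))
    (h3 : ∀ n, ∃ a ∈ S.gaps n, ∃ b ∈ S.gaps n, ∃ c ∈ S.gaps n, a < b ∧ b < c) (C : ℝ) :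
    ∃ q, C ≤ (S.complexity q : ℝ) - 1.5 * q := by
  obtain ⟨N, hN⟩ := exists_nat_ge (20 * |C| + 20)
  obtain ⟨n, hn, x, hx, hxn⟩ := exists_small_gap hK N
  obtain ⟨a', ha', b, hb, c, hc, hab, hbc⟩ := h3 n
  obtain ⟨a, ha, hmin⟩ : ∃ a ∈ S.gaps n, ∀ y ∈ S.gaps n, a ≤ y :=
    ⟨sInf (S.gaps n), Nat.sInf_mem ⟨a', ha'⟩, fun y hy => Nat.sInf_le hy⟩
  have h := S.twoSpecial_of_three_gaps n ha hb hc ((hmin a' ha').trans_lt hab) hbc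
  have h1 := h.complexity (by omega)
  have h2 : 10 * a ≤ (S.P n).length :=
    (Nat.mul_le_mul_left 10 (hmin x ⟨n, le_rfl, hx⟩)).trans hxn
  -- At this length the complexity is at least `2 |P n|`, while `1.5 q ≤ 1.65 |P n| + 1.5` because
  -- `a ≤ |P n| / 10`.
  refine ⟨(S.P n).length + a + 1, ?_⟩
  have h3 : 2 * (S.P n).length ≤ S.complexity ((S.P n).length + a + 1) := by omega
  have h4 : (2 * (S.P n).length : ℝ) ≤ S.complexity ((S.P n).length + a + 1) := by exact_mod_cast h3
  have h5 : (10 * a : ℝ) ≤ (S.P n).length := by exact_mod_cast h2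
  have h6 : (N : ℝ) ≤ (S.P n).length := by exact_mod_cast hn.trans (S.lt_length_P n).le
  have h7 := le_abs_self C
  push_cast
  have h8 := abs_nonneg C
  norm_num
  linarith

lemma Nonconstant.le_complexity (hS : S.Nonconstant) (q : ℕ) : q ≤ S.complexity q := by
  have := hS.complexity_mono (Nat.zero_le q)
  omega

lemma exists_complexity_ge_of_two_gaps (hS : S.Nonconstant) {a b n₀ : ℕ} (hab : a < b)
    (ha : ∀ n, a ∈ S.gaps n) (hb : ∀ n, b ∈ S.gaps n) (hn₀ : S.gaps n₀ ⊆ {a, b}) (C : ℝ) :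
    ∃ q, C ≤ (S.complexity q : ℝ) - 1.5 * q := by
  have hblock : ∀ H : ℕ, ∃ w, S.IsBlock {a, b} w ∧ H ≤ w.length := fun H =>
    ⟨S.P (max n₀ H), (S.isBlock_P _).mono ((S.gaps_anti (le_max_left _ _)).trans hn₀),
      (le_max_right _ _).trans (S.lt_length_P _).le⟩
  -- Either alternative gives a nonempty range with two right special words once `w` is longer than
  -- `2a`, and each range raises `p(q) - q` by at least one.
  have hunb : ∀ k : ℕ, ∃ q, q + k ≤ S.complexity q := by
    intro k
    induction k with
    | zero => exact ⟨0, by simp⟩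
    | succ k ih =>
      obtain ⟨q, hq⟩ := ih
      obtain ⟨w, hw, hwq⟩ := hblock (max q (2 * a + 1))
      have hwq1 := (le_max_left _ _).trans hwq
      have hwq2 := (le_max_right _ _).trans hwq
      obtain ⟨α, β, hα, hαβ, h⟩ : ∃ α β, q ≤ α ∧ α < β ∧ S.TwoSpecial α β := by
        rcases S.twoSpecial_of_two_gaps hab hw ha hb with ⟨α, β, h1, h2, h3⟩ | ⟨Q, -, h2, h3⟩
        · exact ⟨α, β, by omega, by omega, h3⟩
        · exact ⟨_, _, by omega, by omega, h3⟩
      have h1 := h.complexity hαβ.le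
      have h2 := hS.complexity_mono (show q ≤ α + 1 by omega)
      exact ⟨β + 1, by omega⟩
  by_cases hgood : ∀ H : ℕ, ∃ w α β, H ≤ w ∧ w ≤ α ∧ 2 * α ≤ β + 2 * a ∧ S.TwoSpecial α β
  · obtain ⟨k, hk⟩ := exists_nat_ge (C + a + 1)
    obtain ⟨q, hq⟩ := hunb k
    obtain ⟨w, α, β, h1, h2, h3, h4⟩ := hgood (max q (2 * a))
    have hwq1 := (le_max_left _ _).trans h1
    have hwq2 := (le_max_right _ _).trans h1
    have h5 := h4.complexity (by omega)
    have h6 := hS.complexity_mono (show q ≤ α + 1 by omega)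
    refine ⟨β + 1, ?_⟩
    -- As `α ≤ β / 2 + a`, this bounds the complexity below by `1.5 β + 1 + k - a`.
    have h7 : 2 * β + 1 + k ≤ S.complexity (β + 1) + α := by omega
    have h8 : (2 * β + 1 + k : ℝ) ≤ S.complexity (β + 1) + α := by exact_mod_cast h7
    have h9 : (2 * α : ℝ) ≤ β + 2 * a := by exact_mod_cast h3
    push_cast
    norm_num
    linarith
  · push Not at hgood
    obtain ⟨H, hH⟩ := hgood
    have hnext : ∀ w, S.IsBlock {a, b} w → H ≤ w.length → ∃ Q, S.IsBlock {a, b} Q ∧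
        2 * w.length ≤ Q.length ∧
        S.TwoSpecial (2 * a + Q.length) (2 * a + (2 * Q.length - w.length)) := by
      intro w hw hwH
      rcases S.twoSpecial_of_two_gaps hab hw ha hb with ⟨α, β, h1, h2, h3⟩ | h
      · exact absurd h3 (hH _ α β hwH h1 h2)
      · exact h
    obtain ⟨w₀, hw₀, hw₀H⟩ := hblock H
    -- The invariant is `p(q) ≥ q + |w| - |w₀|` at `q = 2a + 2|w| + 1`. Growth with slope 1 up to
    -- the range of `Q` and slope 2 on it gives excess `|Q| - |w₀|` already at `2a + 2|Q| - |w| +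
    -- 1`.
    have hadv : ∀ w Q : List (Fin 2), 2 * w.length ≤ Q.length →
        S.TwoSpecial (2 * a + Q.length) (2 * a + (2 * Q.length - w.length)) →
        2 * a + 2 * w.length + 1 + w.length ≤
          S.complexity (2 * a + 2 * w.length + 1) + w₀.length →
        2 * a + (2 * Q.length - w.length) + 1 + Q.length ≤
          S.complexity (2 * a + (2 * Q.length - w.length) + 1) + w₀.length := by
      intro w Q h1 h2 h3
      have h4 := h2.complexity (by omega)
      have h5 := hS.complexity_mono
        (show 2 * a + 2 * w.length + 1 ≤ 2 * a + Q.length + 1 by omega)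
      omega
    have hiter : ∀ i : ℕ, ∃ w, S.IsBlock {a, b} w ∧ H ≤ w.length ∧ i ≤ w.length ∧
        2 * a + 2 * w.length + 1 + w.length ≤
          S.complexity (2 * a + 2 * w.length + 1) + w₀.length := by
      intro i
      induction i with
      | zero =>
        exact ⟨w₀, hw₀, hw₀H, Nat.zero_le _, Nat.add_le_add_right (hS.le_complexity _) _⟩
      | succ i ih =>
        obtain ⟨w, hw, h1, h2, h3⟩ := ih
        obtain ⟨Q, hQ, h4, h5⟩ := hnext w hw h1
        have h6 := hadv w Q h4 h5 h3
        have h7 := hS.complexity_mono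
          (show 2 * a + (2 * Q.length - w.length) + 1 ≤ 2 * a + 2 * Q.length + 1 by omega)
        have := hw.1.length_pos
        exact ⟨Q, hQ, by omega, by omega, by omega⟩
    obtain ⟨i, hi⟩ := exists_nat_ge (2 * (C + w₀.length + a + 1))
    obtain ⟨w, hw, h1, h2, h3⟩ := hiter i
    obtain ⟨Q, hQ, h4, h5⟩ := hnext w hw h1
    have h6 := hadv w Q h4 h5 h3
    -- The estimate is taken at the end of the range: with `z = 2|Q| - |w|`, the excess `|Q|` equals
    -- `z / 2 + |w| / 2`, and the second term beats every constant.
    obtain ⟨z, hz⟩ := Nat.exists_eq_add_of_le (show w.length ≤ 2 * Q.length by omega)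
    rw [hz, Nat.add_sub_cancel_left] at h6
    refine ⟨2 * a + z + 1, ?_⟩
    have h8 : (2 * a + z + 1 + Q.length : ℝ) ≤ S.complexity (2 * a + z + 1) + w₀.length := by
      exact_mod_cast h6
    have h9 : (2 * Q.length : ℝ) = w.length + z := by exact_mod_cast hz
    have h10 : (i : ℝ) ≤ w.length := by exact_mod_cast h2
    push_cast
    norm_num
    linarith

/-- A rank-one sequence of words whose lengths grow no faster than the number of copies, and whose
gaps do not become constant, has complexity far above `1.5 q`. -/
theorem exists_complexity_ge (hS : S.Nonconstant) {K : ℝ} (hK : ∀ n, ((S.P n).length : ℝ) ≤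
    K * ∏ m ∈ Finset.range n, (((S.c m).length : ℝ) + 1)) (C : ℝ) :
    ∃ q, C ≤ (S.complexity q : ℝ) - 1.5 * q := by
  by_cases h3 : ∀ n, ∃ a ∈ S.gaps n, ∃ b ∈ S.gaps n, ∃ c ∈ S.gaps n, a < b ∧ b < c
  · exact exists_complexity_ge_of_three_gaps hK h3 C
  push Not at h3
  obtain ⟨n₀, h3⟩ := h3
  obtain ⟨a, ha, b, hb, hab⟩ := hS n₀
  have hsub : S.gaps n₀ ⊆ {a, b} := by
    intro x hx
    by_contra hne
    simp only [Set.mem_insert_iff, Set.mem_singleton_iff, not_or] at hne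
    have h1 := h3 x hx a ha b hb
    have h2 := h3 a ha x hx b hb
    have h4 := h3 a ha b hb x hx
    omega
  have hall : ∀ n, a ∈ S.gaps n ∧ b ∈ S.gaps n := by
    intro n
    obtain ⟨x, hx, y, hy, hxy⟩ := hS (max n₀ n)
    have hx' := hsub (S.gaps_anti (le_max_left _ _) hx)
    have hy' := hsub (S.gaps_anti (le_max_left _ _) hy)
    simp only [Set.mem_insert_iff, Set.mem_singleton_iff] at hx' hy'
    obtain ⟨rfl, rfl⟩ : x = a ∧ y = b := by omega
    exact ⟨S.gaps_anti (le_max_right _ _) hx, S.gaps_anti (le_max_right _ _) hy⟩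
  exact exists_complexity_ge_of_two_gaps hS hab (fun n => (hall n).1) (fun n => (hall n).2) hsub C

end RankOneWords

/-! ### The symbolic model of a cutting and stacking construction -/

lemma ofFn_getD_eq_take_drop {A : Type*} (d : A) (l : List A) (k q : ℕ) (h : k + q ≤ l.length) :
    List.ofFn (fun i : Fin q => l.getD (k + i) d) = (l.drop k).take q := by
  apply List.ext_getElem
  · simp; omega
  · intro i h1 h2
    simp at h1
    simp [List.getD, List.getElem?_eq_getElem (show k + i < l.length by omega)]

/-- In a factorial language in which words can be extended in both directions, each word occurs in
a biinfinite sequence all of whose factors belong to the language. -/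
lemma exists_biinfinite {A : Type*} (L : Set (List A))
    (hfac : ∀ u v, u <:+: v → v ∈ L → u ∈ L) (hl : ∀ u ∈ L, ∃ x, x :: u ∈ L)
    (hr : ∀ u ∈ L, ∃ x, u ++ [x] ∈ L) {u : List A} (hu : u ∈ L) :
    ∃ x : ℤ → A, (∀ (k : ℤ) (q : ℕ), List.ofFn (fun i : Fin q => x (k + (i : ℕ))) ∈ L) ∧
      u = List.ofFn (fun i : Fin u.length => x (0 + (i : ℕ))) := by
  have hext : ∀ v : L, ∃ v' : L, ∃ x y, v'.1 = x :: (v.1 ++ [y]) := by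
    rintro ⟨v, hv⟩
    obtain ⟨y, hy⟩ := hr v hv
    obtain ⟨x, hx⟩ := hl _ hy
    exact ⟨⟨_, hx⟩, x, y, rfl⟩
  choose next a b hnext using hext
  set U : ℕ → L := fun n => next^[n] ⟨u, hu⟩ with hU
  have hUs : ∀ n, (U (n + 1)).1 = a (U n) :: ((U n).1 ++ [b (U n)]) := by
    intro n
    rw [← hnext, hU]
    simp only [Function.iterate_succ_apply']
  have hlen : ∀ n, (U n).1.length = u.length + 2 * n := by
    intro n
    induction n with
    | zero => simp [hU]
    | succ n ih => rw [hUs]; simp [ih]; omega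
  obtain ⟨d, -⟩ := hl u hu
  have hstable : ∀ n m i, n ≤ m → i < (U n).1.length →
      (U m).1.getD (i + (m - n)) d = (U n).1.getD i d := by
    intro n m i hnm hi
    induction m, hnm using Nat.le_induction with
    | base => simp
    | succ m hm ih =>
      rw [← ih, hUs, show i + (m + 1 - n) = (i + (m - n)) + 1 by omega, List.getD_cons_succ,
        List.getD_append]
      rw [hlen] at hi ⊢
      omega
  -- `U n` adds `n` letters on each side of `u`, so coordinate `i` sits at index `i + n` of `U n`
  -- for every large `n`.
  set x : ℤ → A := fun i => (U (i.natAbs + 1)).1.getD (i + (i.natAbs + 1)).toNat d with hx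
  have hxU : ∀ (i : ℤ) (n : ℕ), i.natAbs + 1 ≤ n → x i = (U n).1.getD (i + n).toNat d := by
    intro i n hn
    rw [hx]
    simp only
    rw [← hstable (i.natAbs + 1) n _ hn (by rw [hlen]; omega)]
    congr 1
    omega
  have hwin : ∀ (k : ℤ) (q n : ℕ), k.natAbs + q + 1 ≤ n →
      List.ofFn (fun i : Fin q => x (k + (i : ℕ))) = ((U n).1.drop (k + n).toNat).take q := by
    intro k q n hn
    rw [← ofFn_getD_eq_take_drop d _ _ _ (by rw [hlen]; omega)]
    congr 1
    ext i
    rw [hxU _ n (by omega)]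
    congr 1
    omega
  refine ⟨x, fun k q => ?_, ?_⟩
  · rw [hwin k q _ le_rfl]
    exact hfac _ _ ((List.take_prefix _ _).isInfix.trans (List.drop_suffix _ _).isInfix) (U _).2
  · refine List.ext_getElem (by simp) fun i hi _ => ?_
    rw [List.getElem_ofFn, hxU _ (i + 1) (by simp),
      show ((0 : ℤ) + (i : ℕ) + (i + 1 : ℕ)).toNat = i + (i + 1 - 0) by omega,
      hstable 0 (i + 1) i (Nat.zero_le _) hi]
    simp [hU, List.getD, List.getElem?_eq_getElem hi]

namespace CuttingData

variable (D : CuttingData)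

/-- The number of letters `1` at the end of the word `B n`. -/
def trailing (n : ℕ) : ℕ := ∑ m ∈ Finset.range n, D.s m (D.r m)

/-- The words `B n` without their final letters `1`. -/
def trimmed : ℕ → List (Fin 2)
  | 0 => [0]
  | n + 1 => expand (trimmed n) ((List.range (D.r n)).map fun i => D.trailing n + D.s n i)

/-- The rank-one sequence of words of a cutting and stacking construction. -/
def rankOneWords : RankOneWords where
  P := D.trimmed
  c n := (List.range (D.r n)).map fun i => D.trailing n + D.s n i
  zeroEnded := ⟨⟨[], rfl⟩, ⟨[], rfl⟩⟩
  c_ne_nil n := by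
    have := D.one_le_r n
    simp; omega
  step n := rfl

lemma word_eq (n : ℕ) : D.word n = D.trimmed n ++ List.replicate (D.trailing n) 1 := by
  induction n with
  | zero => simp [word, trimmed, trailing]
  | succ n ih =>
    have key : ∀ (l : List ℕ) (z : ℕ),
        (l ++ [z]).flatMap (fun i => D.word n ++ List.replicate (D.s n i) 1) =
        expand (D.trimmed n) (l.map fun i => D.trailing n + D.s n i) ++
          List.replicate (D.trailing n + D.s n z) 1 := by
      intro l z
      induction l with
      | nil => simp [expand, ih]
      | cons y l ihl =>
        rw [List.cons_append, List.flatMap_cons, ihl, ih]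
        simp [expand]
    rw [word, List.range_succ, key, trimmed, trailing, trailing, Finset.sum_range_succ]

/-- The letters `1` trimmed off `D.word n` reappear in the first gap of the next trimmed word, which
therefore has `D.word n` as a prefix. -/
lemma lang_rankOneWords : D.rankOneWords.lang = {u | ∃ n, u <:+: D.word n} := by
  ext u
  constructor
  · rintro ⟨m, hm⟩
    refine ⟨m, hm.trans ?_⟩
    rw [word_eq]
    exact (List.prefix_append _ _).isInfix
  · rintro ⟨n, hn⟩
    refine ⟨n + 1, hn.trans ?_⟩
    obtain ⟨x, l, hl⟩ := List.exists_cons_of_ne_nil (D.rankOneWords.c_ne_nil n)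
    have hx : x ∈ D.rankOneWords.c n := by rw [hl]; simp
    obtain ⟨i, -, rfl⟩ := List.mem_map.1 hx
    rw [word_eq, D.rankOneWords.step, hl]
    refine List.IsPrefix.isInfix ⟨List.replicate (D.s n i) 1 ++
      expand (D.trimmed n) l, ?_⟩
    simp only [rankOneWords, expand, List.replicate_add, List.append_assoc]

lemma wordComplexity_subshift (q : ℕ) :
    wordComplexity D.subshift q = D.rankOneWords.complexity q := by
  have : ∀ u, u ∈ subshiftLanguage D.subshift ↔ u ∈ D.rankOneWords.lang := by
    intro u
    constructor
    · rintro ⟨x, hx, k, hu⟩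
      rw [lang_rankOneWords, hu]
      exact hx k _
    · intro hu
      obtain ⟨x, h1, h2⟩ := exists_biinfinite D.rankOneWords.lang
        (fun u v h hv => D.rankOneWords.lang_of_infix h hv)
        (fun u hu => D.rankOneWords.exists_cons_mem_lang hu)
        (fun u hu => D.rankOneWords.exists_append_mem_lang hu) hu
      refine ⟨x, fun k q => ?_, 0, h2⟩
      have := h1 k q
      rwa [lang_rankOneWords] at this
  simp only [wordComplexity, RankOneWords.complexity, this]

lemma length_word (n : ℕ) : (D.word n).length = D.height n := by
  induction n with
  | zero => rfl
  | succ n ih =>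
    have key : ∀ k, ((List.range k).flatMap
        (fun i => D.word n ++ List.replicate (D.s n i) 1)).length =
        ∑ i ∈ Finset.range k, (D.height n + D.s n i) := by
      intro k
      induction k with
      | zero => rfl
      | succ k ihk =>
        rw [List.range_succ, List.flatMap_append, List.length_append, ihk, Finset.sum_range_succ]
        simp [ih]
    rw [word, key, height]

lemma length_trimmed_le (n : ℕ) : (D.trimmed n).length ≤ D.height n := by
  rw [← length_word, word_eq]; simp

/-- If the gaps become constant, then from some stage on the same number of spacers is put between
any two consecutive subcolumns, and none on top of the last one. -/
lemma exists_constant_spacers (h : ¬ D.rankOneWords.Nonconstant) :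
    ∃ N d, ∀ m, N ≤ m → (∀ i < D.r m, D.s m i = d) ∧ D.s m (D.r m) = 0 := by
  simp only [RankOneWords.Nonconstant] at h
  push Not at h
  obtain ⟨n, hn⟩ := h
  obtain ⟨c, hc⟩ := D.rankOneWords.gaps_nonempty n
  have hall : ∀ m, n ≤ m → ∀ i < D.r m, D.trailing m + D.s m i = c := by
    intro m hm i hi
    have : D.trailing m + D.s m i ∈ D.rankOneWords.gaps n :=
      ⟨m, hm, List.mem_map.2 ⟨i, by simpa using hi, rfl⟩⟩
    exact le_antisymm (hn _ hc _ this) (hn _ this _ hc)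
  have hmono : Monotone D.trailing := monotone_nat_of_le_succ fun m => by
    simp [trailing, Finset.sum_range_succ]
  have hbdd : ∀ m, D.trailing m ≤ c := by
    intro m
    have := hall (max n m) (le_max_left _ _) 0 (D.one_le_r _)
    have := hmono (le_max_right n m)
    omega
  -- A bounded monotone sequence of naturals stabilises; afterwards no spacers go on top and the
  -- other spacer counts are constant.
  obtain ⟨N, hN⟩ : ∃ N, ∀ m, D.trailing m ≤ D.trailing N := by
    have hfin : (Set.range D.trailing).Finite :=
      (Set.finite_Iic c).subset (by rintro _ ⟨m, rfl⟩; exact hbdd m)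
    obtain ⟨_, ⟨N, rfl⟩, hmax⟩ := Set.exists_max_image _ id hfin ⟨_, 0, rfl⟩
    exact ⟨N, fun m => hmax _ ⟨m, rfl⟩⟩
  have heq : ∀ m, N ≤ m → D.trailing m = D.trailing N := fun m hm => le_antisymm (hN m) (hmono hm)
  refine ⟨max n N, c - D.trailing N, fun m hm => ⟨fun i hi => ?_, ?_⟩⟩
  · have h1 := hall m ((le_max_left _ _).trans hm) i hi
    have h2 := heq m ((le_max_right _ _).trans hm)
    omega
  · have h1 := heq m ((le_max_right _ _).trans hm)
    have h2 := heq (m + 1) (((le_max_right _ _).trans hm).trans m.le_succ)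
    have h3 : D.trailing (m + 1) = D.trailing m + D.s m (D.r m) := by
      simp [trailing, Finset.sum_range_succ]
    omega

end CuttingData

/-! ### Measures of levels. -/

namespace CuttingData

lemma height_succ (D : CuttingData) (n : ℕ) :
    D.height (n + 1) = D.offset n (D.r n) + D.height n + D.s n (D.r n) := by
  rw [height, Finset.sum_range_succ, offset, add_assoc]

lemma offset_add_lt_height (D : CuttingData) {n i j : ℕ} (hi : i ≤ D.r n) (hj : j < D.height n) :
    D.offset n i + j < D.height (n + 1) := by
  have : D.offset n i ≤ D.offset n (D.r n) :=
    Finset.sum_le_sum_of_subset (Finset.range_mono hi)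
  rw [height_succ]
  omega

lemma lt_height (D : CuttingData) (n : ℕ) : n < D.height n := by
  have h1 := D.rankOneWords.lt_length_P n
  exact h1.trans_le (D.length_trimmed_le n)

namespace IsColumns

variable {D : CuttingData} {Y : Type*} [MeasurableSpace Y] {μ : Measure Y} {T : Y → Y}
  {I : ℕ → ℕ → Set Y}

lemma measure_level (h : D.IsColumns μ T I) (hT : MeasurePreserving T μ μ) (n j : ℕ)
    (hj : j < D.height n) : μ (I n j) = μ (I n 0) := by
  induction j with
  | zero => rfl
  | succ j ih =>
    rw [← ih (by omega), ← measure_congr (h.climb n j hj)]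
    exact (hT.measure_preimage (h.measurableSet n _ hj).nullMeasurableSet).symm

lemma height_mul_measure_le_one (h : D.IsColumns μ T I) [IsProbabilityMeasure μ]
    (hT : MeasurePreserving T μ μ) (n : ℕ) : D.height n * μ (I n 0) ≤ 1 := by
  have h1 : μ (⋃ j ∈ Finset.range (D.height n), I n j) = D.height n * μ (I n 0) := by
    rw [measure_biUnion_finset]
    · rw [Finset.sum_congr rfl fun j hj => h.measure_level hT n j (Finset.mem_range.1 hj)]
      simp
    · intro i hi j hj hij
      exact h.disjoint n i j (by simpa using hi) (by simpa using hj) hij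
    · intro j hj
      exact h.measurableSet n j (Finset.mem_range.1 hj)
  rw [← h1]
  exact prob_le_one

lemma measure_zero_eq (h : D.IsColumns μ T I) (hT : MeasurePreserving T μ μ) (n : ℕ) :
    μ (I n 0) = (D.r n + 1) * μ (I (n + 1) 0) := by
  have hpos : 0 < D.height n := Nat.zero_lt_of_lt (D.lt_height n)
  rw [h.cut n 0 hpos, measure_biUnion_finset]
  · rw [Finset.sum_congr rfl fun i hi => h.measure_level hT (n + 1) _
      (D.offset_add_lt_height (by simpa [Nat.lt_succ_iff] using hi) hpos)]
    simp
  · intro i hi j hj hij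
    refine h.disjoint (n + 1) _ _
      (D.offset_add_lt_height (by simpa [Nat.lt_succ_iff] using hi) hpos)
      (D.offset_add_lt_height (by simpa [Nat.lt_succ_iff] using hj) hpos) ?_
    have hmono : StrictMono (D.offset n) := strictMono_nat_of_lt_succ fun i => by
      rw [offset, offset, Finset.sum_range_succ]; omega
    intro heq
    exact hij (hmono.injective (by simpa using heq))
  · intro i hi
    exact h.measurableSet _ _ (D.offset_add_lt_height (by simpa [Nat.lt_succ_iff] using hi) hpos)

lemma measure_zero_eq_prod (h : D.IsColumns μ T I) (hT : MeasurePreserving T μ μ) (n : ℕ) :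
    μ (I 0 0) = (∏ m ∈ Finset.range n, ((D.r m : ENNReal) + 1)) * μ (I n 0) := by
  induction n with
  | zero => simp
  | succ n ih => rw [ih, Finset.prod_range_succ, h.measure_zero_eq hT n, mul_assoc]

lemma measure_base_ne_zero (h : D.IsColumns μ T I) [IsProbabilityMeasure μ]
    (hT : MeasurePreserving T μ μ) : μ (I 0 0) ≠ 0 := by
  intro h0
  have hn : ∀ n, μ (I n 0) = 0 := by
    intro n
    have := h.measure_zero_eq_prod hT n
    rw [h0] at this
    rcases mul_eq_zero.1 this.symm with h1 | h1
    · obtain ⟨m, -, hm⟩ := Finset.prod_eq_zero_iff.1 h1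
      simp at hm
    · exact h1
  have hnull : μ (⋃ n, ⋃ j ∈ Finset.range (D.height n), I n j) = 0 := by
    rw [measure_iUnion_null_iff]
    intro n
    refine (measure_biUnion_null_iff (Finset.countable_toSet _)).2 fun j hj => ?_
    rw [h.measure_level hT n j (by simpa using hj), hn]
  have hall : ∀ᵐ y ∂μ, y ∈ ⋃ n, ⋃ j ∈ Finset.range (D.height n), I n j := by
    filter_upwards [h.exhaust] with y hy
    simpa using hy
  have := (prob_compl_eq_zero_iff₀ (μ := μ)
    (s := ⋃ n, ⋃ j ∈ Finset.range (D.height n), I n j) ?_).1 hall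
  · rw [hnull] at this
    exact zero_ne_one this
  · exact (MeasurableSet.iUnion fun n => MeasurableSet.biUnion (Finset.countable_toSet _)
      fun j hj => h.measurableSet n j (by simpa using hj)).nullMeasurableSet

/-- Column `n` has total measure at most `1`, and each of its levels has the measure of `I 0 0`
divided by the number of copies. -/
lemma exists_length_le (h : D.IsColumns μ T I) [IsProbabilityMeasure μ]
    (hT : MeasurePreserving T μ μ) : ∃ K : ℝ, ∀ n, ((D.rankOneWords.P n).length : ℝ) ≤
      K * ∏ m ∈ Finset.range n, (((D.rankOneWords.c m).length : ℝ) + 1) := by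
  refine ⟨(μ.real (I 0 0))⁻¹, fun n => ?_⟩
  have h0 : 0 < μ.real (I 0 0) :=
    ENNReal.toReal_pos (h.measure_base_ne_zero hT) (measure_ne_top _ _)
  have h1 : μ.real (I 0 0) = (∏ m ∈ Finset.range n, ((D.r m : ℝ) + 1)) * μ.real (I n 0) := by
    rw [Measure.real, h.measure_zero_eq_prod hT n, ENNReal.toReal_mul, ENNReal.toReal_prod]
    congr 1
  have h2 : (D.height n : ℝ) * μ.real (I n 0) ≤ 1 := by
    have := ENNReal.toReal_mono ENNReal.one_ne_top (h.height_mul_measure_le_one hT n)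
    simpa [Measure.real] using this
  have h3 : ((D.rankOneWords.P n).length : ℝ) ≤ D.height n := by
    exact_mod_cast D.length_trimmed_le n
  have h4 : ∏ m ∈ Finset.range n, (((D.rankOneWords.c m).length : ℝ) + 1) =
      ∏ m ∈ Finset.range n, ((D.r m : ℝ) + 1) := by simp [rankOneWords]
  rw [h4, inv_mul_eq_div, le_div_iff₀ h0, h1]
  set R := ∏ m ∈ Finset.range n, ((D.r m : ℝ) + 1)
  have hR : 0 ≤ R := Finset.prod_nonneg fun m _ => by positivity
  calc ((D.rankOneWords.P n).length : ℝ) * (R * μ.real (I n 0))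
      ≤ D.height n * (R * μ.real (I n 0)) := by gcongr
    _ = R * (D.height n * μ.real (I n 0)) := by ring
    _ ≤ R * 1 := by gcongr
    _ = R := mul_one R

lemma measure_base_le (h : D.IsColumns μ T I) [IsProbabilityMeasure μ]
    (hT : MeasurePreserving T μ μ) (n : ℕ) : μ (I n 0) ≤ (n : ENNReal)⁻¹ := by
  rw [ENNReal.le_inv_iff_mul_le, mul_comm]
  refine le_trans ?_ (h.height_mul_measure_le_one hT n)
  gcongr
  exact (D.lt_height n).le

end IsColumns

end CuttingData

/-! ### Eventually constant spacers give an odometer. -/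

namespace CuttingData

/-- From stage `N` on, `d` spacers are put between consecutive subcolumns and none on the top. -/
def HasConstantSpacers (D : CuttingData) (N d : ℕ) : Prop :=
  ∀ m, N ≤ m → (∀ i < D.r m, D.s m i = d) ∧ D.s m (D.r m) = 0

/-- The modification of `D` which puts `d` spacers on each subcolumn at stage `N`, and none
afterwards. -/
def fillSpacers (D : CuttingData) (N d : ℕ) : CuttingData where
  r := D.r
  s n i := if n < N then D.s n i else if n = N then d else 0
  one_le_r := D.one_le_r

variable {D : CuttingData} {N d : ℕ}

lemma HasConstantSpacers.offset_eq (h : D.HasConstantSpacers N d) {m : ℕ} (hm : N ≤ m) {i : ℕ}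
    (hi : i ≤ D.r m) : D.offset m i = i * (D.height m + d) := by
  rw [offset, Finset.sum_congr rfl fun l hl => by
    rw [(h m hm).1 l (by have := Finset.mem_range.1 hl; omega)]]
  simp

/-- Only the last subcolumn lacks its `d` spacers. Thus `height + d` is multiplicative, and heights
modulo `D.height m + d` are preserved in later columns. -/
lemma HasConstantSpacers.height_succ (h : D.HasConstantSpacers N d) {m : ℕ} (hm : N ≤ m) :
    D.height (m + 1) + d = (D.r m + 1) * (D.height m + d) := by
  rw [D.height_succ, h.offset_eq hm le_rfl, (h m hm).2]
  ring

lemma HasConstantSpacers.dvd (h : D.HasConstantSpacers N d) {m M : ℕ} (hm : N ≤ m) (hM : m ≤ M) :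
    D.height m + d ∣ D.height M + d := by
  induction M, hM using Nat.le_induction with
  | base => exact dvd_rfl
  | succ M hM ih => rw [h.height_succ (hm.trans hM)]; exact ih.mul_left _

lemma fillSpacers_height_of_le (n : ℕ) (hn : n ≤ N) :
    (D.fillSpacers N d).height n = D.height n := by
  induction n with
  | zero => rfl
  | succ n ih =>
    rw [height, height, ih (by omega)]
    refine Finset.sum_congr rfl fun i _ => ?_
    rw [fillSpacers]
    simp only
    rw [if_pos (by omega)]

lemma fillSpacers_offset_of_lt {n : ℕ} (hn : n < N) (i : ℕ) :
    (D.fillSpacers N d).offset n i = D.offset n i := by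
  rw [offset, offset, fillSpacers_height_of_le n hn.le]
  refine Finset.sum_congr rfl fun i _ => ?_
  rw [fillSpacers]
  simp only
  rw [if_pos hn]

lemma HasConstantSpacers.fillSpacers_height (h : D.HasConstantSpacers N d) (n : ℕ) (hn : N < n) :
    (D.fillSpacers N d).height n = D.height n + d := by
  induction n, hn using Nat.le_induction with
  | base =>
    rw [h.height_succ le_rfl, height, fillSpacers_height_of_le N le_rfl]
    simp [fillSpacers]
  | succ n hn ih =>
    rw [h.height_succ (by omega), height, ih]
    simp [fillSpacers, show ¬ n < N by omega, show n ≠ N by omega]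

lemma HasConstantSpacers.fillSpacers_offset (h : D.HasConstantSpacers N d) {n : ℕ} (hn : N ≤ n)
    (i : ℕ) : (D.fillSpacers N d).offset n i = i * (D.height n + d) := by
  rw [offset]
  rcases hn.eq_or_lt with rfl | hn
  · rw [fillSpacers_height_of_le N le_rfl]
    simp [fillSpacers]
  · rw [h.fillSpacers_height n hn]
    simp [fillSpacers, show ¬ n < N by omega, show n ≠ N by omega]

/-- The levels of the columns obtained by adding the spacers above column `m`: the points whose
height in some late column is congruent to `j`. -/
def filledLevel (D : CuttingData) (d : ℕ) {Y : Type*} (I : ℕ → ℕ → Set Y) (m j : ℕ) : Set Y :=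
  {y | ∃ M l, m ≤ M ∧ l < D.height M ∧ l % (D.height m + d) = j ∧ y ∈ I M l}

namespace IsColumns

variable {Y : Type*} [MeasurableSpace Y] {μ : Measure Y} {T : Y → Y} {I : ℕ → ℕ → Set Y}

lemma exists_mem_level_succ (h : D.IsColumns μ T I) {n j : ℕ} (hj : j < D.height n) {y : Y}
    (hy : y ∈ I n j) : ∃ i ≤ D.r n, y ∈ I (n + 1) (D.offset n i + j) := by
  rw [h.cut n j hj] at hy
  simpa [Nat.lt_succ_iff] using hy

lemma exists_mem_level (h : D.IsColumns μ T I) {n m j : ℕ} (hnm : n ≤ m) (hj : j < D.height n)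
    {y : Y} (hy : y ∈ I n j) : ∃ l < D.height m, y ∈ I m l := by
  induction m, hnm using Nat.le_induction with
  | base => exact ⟨j, hj, hy⟩
  | succ m hm ih =>
    obtain ⟨l, hl, hyl⟩ := ih
    obtain ⟨i, hi, hyi⟩ := h.exists_mem_level_succ hl hyl
    exact ⟨_, D.offset_add_lt_height hi hl, hyi⟩

lemma level_unique (h : D.IsColumns μ T I) {n i j : ℕ} (hi : i < D.height n)
    (hj : j < D.height n) {y : Y} (hyi : y ∈ I n i) (hyj : y ∈ I n j) : i = j := by
  by_contra hij
  exact (Set.disjoint_left.1 (h.disjoint n i j hi hj hij)) hyi hyj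

lemma exists_biUnion_levels (h : D.IsColumns μ T I) {n m : ℕ} (hnm : n ≤ m) {J : Finset ℕ}
    (hJ : J ⊆ Finset.range (D.height n)) :
    ∃ J' ⊆ Finset.range (D.height m), ⋃ j ∈ J, I n j = ⋃ j ∈ J', I m j := by
  induction m, hnm using Nat.le_induction with
  | base => exact ⟨J, hJ, rfl⟩
  | succ m hm ih =>
    obtain ⟨J', hJ', heq⟩ := ih
    refine ⟨(Finset.range (D.r m + 1) ×ˢ J').image fun p => D.offset m p.1 + p.2, ?_, ?_⟩
    · intro x hx
      obtain ⟨⟨i, j⟩, hij, rfl⟩ := Finset.mem_image.1 hx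
      obtain ⟨hi, hj⟩ := Finset.mem_product.1 hij
      exact Finset.mem_range.2 (D.offset_add_lt_height
        (Nat.lt_succ_iff.1 (Finset.mem_range.1 hi)) (Finset.mem_range.1 (hJ' hj)))
    · rw [heq]
      ext y
      simp only [Set.mem_iUnion, Finset.mem_image, Finset.mem_product, exists_prop, Prod.exists]
      constructor
      · rintro ⟨j, hj, hy⟩
        obtain ⟨i, hi, hyi⟩ := h.exists_mem_level_succ (Finset.mem_range.1 (hJ' hj)) hy
        exact ⟨_, ⟨i, j, ⟨Finset.mem_range.2 (by omega), hj⟩, rfl⟩, hyi⟩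
      · rintro ⟨_, ⟨i, j, ⟨hi, hj⟩, rfl⟩, hy⟩
        refine ⟨j, hj, ?_⟩
        rw [h.cut m j (Finset.mem_range.1 (hJ' hj))]
        exact Set.mem_biUnion hi hy

lemma exists_mem_level_mod (h : D.IsColumns μ T I) (hD : D.HasConstantSpacers N d)
    {m M M' l : ℕ} (hm : N ≤ m) (hM : m ≤ M) (hM' : M ≤ M') (hl : l < D.height M) {y : Y}
    (hy : y ∈ I M l) : ∃ l' < D.height M', y ∈ I M' l' ∧
      l' % (D.height m + d) = l % (D.height m + d) := by
  induction M', hM' using Nat.le_induction with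
  | base => exact ⟨l, hl, hy, rfl⟩
  | succ M' hM' ih =>
    obtain ⟨l', hl', hyl, hmod⟩ := ih
    obtain ⟨i, hi, hyi⟩ := h.exists_mem_level_succ hl' hyl
    refine ⟨_, D.offset_add_lt_height hi hl', hyi, ?_⟩
    rw [hD.offset_eq (by omega) hi, ← hmod]
    obtain ⟨k, hk⟩ := hD.dvd hm (hM.trans hM')
    rw [hk, mul_left_comm, Nat.mul_add_mod]

lemma filledLevel_eq (h : D.IsColumns μ T I) (hD : D.HasConstantSpacers N d) {m j : ℕ}
    (hm : N ≤ m) (hj : j < D.height m) : filledLevel D d I m j = I m j := by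
  refine Set.Subset.antisymm ?_ fun y hy => ⟨m, j, le_rfl, hj, Nat.mod_eq_of_lt (by omega), hy⟩
  rintro y ⟨M, l, hM, hl, hmod, hy⟩
  induction M, hM using Nat.le_induction generalizing l with
  | base => rw [Nat.mod_eq_of_lt (by omega)] at hmod; exact hmod ▸ hy
  | succ M hM ih =>
    have hH : 0 < D.height M + d := by have := D.lt_height M; omega
    have hsucc := hD.height_succ (hm.trans hM)
    obtain ⟨k, hk⟩ := hD.dvd hm hM
    have hl0 : l % (D.height M + d) % (D.height m + d) = j := by
      rw [← hmod, Nat.mod_mod_of_dvd _ (hD.dvd hm hM)]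
    have hi : l / (D.height M + d) ≤ D.r M := by
      rw [← Nat.lt_succ_iff, Nat.div_lt_iff_lt_mul hH]
      rw [Nat.succ_eq_add_one, ← hsucc]; omega
    -- Otherwise the residue lies in the last `d` places below a multiple of `D.height m + d`, which
    -- forces `j ≥ D.height m`.
    have hlt : l % (D.height M + d) < D.height M := by
      by_contra hge
      obtain ⟨x, hx⟩ := Nat.exists_eq_add_of_lt (Nat.mod_lt l hH)
      have hk0 : k ≠ 0 := by rintro rfl; omega
      obtain ⟨k', rfl⟩ := Nat.exists_eq_succ_of_ne_zero hk0
      have h1 : l % (D.height M + d) =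
          (D.height m + d) * k' + (D.height m + d - 1 - x) := by
        rw [Nat.mul_succ] at hk
        omega
      rw [h1, Nat.mul_add_mod, Nat.mod_eq_of_lt (by omega)] at hl0
      omega
    refine ih _ hlt hl0 ?_
    rw [h.cut M _ hlt]
    refine Set.mem_biUnion (x := l / (D.height M + d)) (Finset.mem_range.2 (by omega)) ?_
    rw [hD.offset_eq (hm.trans hM) hi, Nat.div_add_mod']
    exact hy

/-- The top level of column `n` has measure at most `1 / n`, so almost no point lies in the top
levels of all late columns. -/
lemma ae_exists_not_mem_top (h : D.IsColumns μ T I) [IsProbabilityMeasure μ]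
    (hT : MeasurePreserving T μ μ) :
    ∀ᵐ y ∂μ, ∀ M₀, ∃ M, M₀ ≤ M ∧ y ∉ I M (D.height M - 1) := by
  rw [ae_all_iff]
  intro M₀
  have hsub : {y | ¬ ∃ M, M₀ ≤ M ∧ y ∉ I M (D.height M - 1)} ⊆
      ⋂ M, I (M₀ + M) (D.height (M₀ + M) - 1) := by
    intro y hy
    simp only [Set.mem_ofPred_eq, not_exists, not_and, not_not] at hy
    exact Set.mem_iInter.2 fun M => hy _ (by omega)
  refine measure_mono_null hsub ?_
  have hle : ∀ n : ℕ, μ (⋂ M, I (M₀ + M) (D.height (M₀ + M) - 1)) ≤ ((n : ℕ) : ENNReal)⁻¹ := by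
    intro n
    refine (measure_mono (Set.iInter_subset _ n)).trans ?_
    rw [h.measure_level hT _ _ (by have := D.lt_height (M₀ + n); omega)]
    refine (h.measure_base_le hT _).trans ?_
    gcongr
    omega
  exact le_antisymm (ge_of_tendsto' ENNReal.tendsto_inv_nat_nhds_zero hle) zero_le

lemma climb_filledLevel (h : D.IsColumns μ T I) [IsProbabilityMeasure μ]
    (hT : MeasurePreserving T μ μ) (hD : D.HasConstantSpacers N d) {m j : ℕ} (hm : N ≤ m)
    (hj : j + 1 < D.height m + d) :
    T ⁻¹' filledLevel D d I m (j + 1) =ᵐ[μ] filledLevel D d I m j := by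
  have hclimb : ∀ᵐ y ∂μ, ∀ M l, l + 1 < D.height M → (T y ∈ I M (l + 1) ↔ y ∈ I M l) := by
    simp only [ae_all_iff]
    intro M l hl
    exact (h.climb M l hl).mem_iff
  filter_upwards [hclimb, h.ae_exists_not_mem_top hT] with y hy htop
  apply propext
  change T y ∈ filledLevel D d I m (j + 1) ↔ y ∈ filledLevel D d I m j
  constructor
  · rintro ⟨M, l, hM, hl, hmod, hyl⟩
    obtain _ | l := l
    · simp at hmod
    · refine ⟨M, l, hM, by omega, ?_, (hy M l hl).1 hyl⟩
      have h1 := Nat.mod_lt l (show 0 < D.height m + d by omega)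
      rw [Nat.add_mod_eq_ite, Nat.mod_eq_of_lt (show 1 < D.height m + d by omega)] at hmod
      split_ifs at hmod <;> omega
  · rintro ⟨M, l, hM, hl, hmod, hyl⟩
    -- In a later column where `y` is not at the top, `T` raises its height, hence the residue, by
    -- one.
    obtain ⟨M', hM', hne⟩ := htop M
    obtain ⟨l', hl', hyl', hmod'⟩ := h.exists_mem_level_mod hD hm hM hM' hl hyl
    have hlt : l' + 1 < D.height M' := by
      by_contra hge
      obtain rfl : l' = D.height M' - 1 := by omega
      exact hne hyl'
    refine ⟨M', l' + 1, hM.trans hM', hlt, ?_, (hy M' l' hlt).2 hyl'⟩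
    rw [Nat.add_mod_eq_ite, Nat.mod_eq_of_lt (show 1 < D.height m + d by omega), hmod', hmod]
    rw [if_neg (by omega)]

lemma cut_filledLevel (h : D.IsColumns μ T I) (hD : D.HasConstantSpacers N d) {m j : ℕ}
    (hm : N ≤ m) (hj : j < D.height m + d) :
    filledLevel D d I m j =
      ⋃ i ∈ Finset.range (D.r m + 1), filledLevel D d I (m + 1) (i * (D.height m + d) + j) := by
  have hpos : 0 < D.height m + d := by omega
  have hdvd := hD.dvd hm m.le_succ
  ext y
  simp only [Set.mem_iUnion, exists_prop, Finset.mem_range]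
  constructor
  · rintro ⟨M, l, hM, hl, hmod, hyl⟩
    obtain ⟨l', hl', hyl', hmod'⟩ := h.exists_mem_level_mod hD hm hM M.le_succ hl hyl
    refine ⟨l' % (D.height (m + 1) + d) / (D.height m + d), ?_,
      M + 1, l', by omega, hl', ?_, hyl'⟩
    · rw [Nat.div_lt_iff_lt_mul hpos, ← hD.height_succ hm]
      exact Nat.mod_lt _ (by have := D.lt_height (m + 1); omega)
    · rw [← hmod, ← hmod', ← Nat.mod_mod_of_dvd l' hdvd, Nat.div_add_mod']
  · rintro ⟨i, hi, M, l, hM, hl, hmod, hyl⟩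
    refine ⟨M, l, by omega, hl, ?_, hyl⟩
    rw [← Nat.mod_mod_of_dvd l hdvd, hmod, mul_comm, Nat.mul_add_mod, Nat.mod_eq_of_lt hj]

lemma fillSpacers (h : D.IsColumns μ T I) [IsProbabilityMeasure μ]
    (hT : MeasurePreserving T μ μ) (hD : D.HasConstantSpacers N d) :
    (D.fillSpacers N d).IsColumns μ T
      (fun n j => if n ≤ N then I n j else filledLevel D d I n j) where
  measurableSet n j hj := by
    split_ifs with hn
    · rw [fillSpacers_height_of_le n hn] at hj
      exact h.measurableSet n j hj
    · have : filledLevel D d I n j = ⋃ M, ⋃ l,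
          ⋃ (_ : n ≤ M ∧ l < D.height M ∧ l % (D.height n + d) = j), I M l := by
        ext y; simp only [filledLevel, Set.mem_iUnion, Set.mem_ofPred_eq, exists_prop, and_assoc]
      rw [this]
      exact MeasurableSet.iUnion fun M => MeasurableSet.iUnion fun l =>
        MeasurableSet.iUnion fun hl => h.measurableSet M l hl.2.1
  disjoint n i j hi hj hij := by
    split_ifs with hn
    · rw [fillSpacers_height_of_le n hn] at hi hj
      exact h.disjoint n i j hi hj hij
    · rw [Set.disjoint_left]
      rintro y ⟨M, l, hM, hl, hmod, hyl⟩ ⟨M', l', hM', hl', hmod', hyl'⟩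
      obtain ⟨k, hk, hyk, hkm⟩ := h.exists_mem_level_mod hD (by omega) hM (le_max_left M M') hl hyl
      obtain ⟨k', hk', hyk', hkm'⟩ :=
        h.exists_mem_level_mod hD (by omega) hM' (le_max_right M M') hl' hyl'
      obtain rfl := h.level_unique hk hk' hyk hyk'
      exact hij (by rw [← hmod, ← hmod', ← hkm, ← hkm'])
  climb n j hj := by
    split_ifs with hn
    · rw [fillSpacers_height_of_le n hn] at hj
      exact h.climb n j hj
    · rw [hD.fillSpacers_height n (by omega)] at hj
      exact h.climb_filledLevel hT hD (by omega) hj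
  cut n j hj := by
    rcases lt_or_ge n N with hn | hn
    · rw [fillSpacers_height_of_le n hn.le] at hj
      simp only [if_pos hn.le, if_pos (Nat.succ_le_of_lt hn), fillSpacers_offset_of_lt hn]
      exact h.cut n j hj
    · have h1 : (if n ≤ N then I n j else filledLevel D d I n j) = filledLevel D d I n j := by
        split_ifs with hn'
        · rw [fillSpacers_height_of_le n hn'] at hj
          exact (h.filledLevel_eq hD hn hj).symm
        · rfl
      have h2 : j < D.height n + d := by
        rcases hn.eq_or_lt with rfl | hn
        · rw [fillSpacers_height_of_le N le_rfl] at hj; omega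
        · rwa [hD.fillSpacers_height n hn] at hj
      simp only [h1, if_neg (show ¬ n + 1 ≤ N by omega), hD.fillSpacers_offset hn]
      exact h.cut_filledLevel hD hn h2
  exhaust := by
    filter_upwards [h.exhaust] with y hy
    obtain ⟨n, j, hj, hyj⟩ := hy
    obtain ⟨l, hl, hyl⟩ := h.exists_mem_level (le_max_left n (N + 1)) hj hyj
    have hN : N + 1 ≤ max n (N + 1) := le_max_right _ _
    refine ⟨max n (N + 1), l, ?_, ?_⟩
    · rw [hD.fillSpacers_height _ (by omega)]; omega
    · rw [if_neg (by omega), h.filledLevel_eq hD (by omega) hl]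
      exact hyl
  approx A hA ε hε := by
    obtain ⟨n, J, hJ, hlt⟩ := h.approx A hA ε hε
    obtain ⟨J', hJ', heq⟩ := h.exists_biUnion_levels (le_max_left n (N + 1)) hJ
    have hN : N + 1 ≤ max n (N + 1) := le_max_right _ _
    refine ⟨max n (N + 1), J', ?_, ?_⟩
    · rw [hD.fillSpacers_height _ (by omega)]
      exact hJ'.trans (Finset.range_mono (by omega))
    · have : (⋃ j ∈ J', if max n (N + 1) ≤ N then I (max n (N + 1)) j
          else filledLevel D d I (max n (N + 1)) j) = ⋃ j ∈ J', I (max n (N + 1)) j := by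
        refine Set.iUnion₂_congr fun j hj => ?_
        rw [if_neg (by omega), h.filledLevel_eq hD (by omega) (Finset.mem_range.1 (hJ' hj))]
      rw [this, ← heq]
      exact hlt

end IsColumns

lemma Constructs.isOdometer {Y : Type*} [MeasurableSpace Y] {μ : Measure Y}
    [IsProbabilityMeasure μ] {T : Y → Y} (hT : MeasurePreserving T μ μ)
    (h : D.Constructs μ T) (hD : D.HasConstantSpacers N d) : IsOdometer μ T := by
  obtain ⟨I, hI⟩ := h
  refine ⟨D.fillSpacers N d, ⟨_, hI.fillSpacers hT hD⟩, N + 1, fun n hn i _ => ?_⟩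
  simp [CuttingData.fillSpacers, show ¬ n < N by omega, show n ≠ N by omega]

end CuttingData

theorem theorem3p3 {Y : Type*} [MeasurableSpace Y] (μ : Measure Y) [IsProbabilityMeasure μ]
    (T : Y → Y) (hT : MeasurePreserving T μ μ)
    (D : CuttingData) (hD : D.Constructs μ T) (hodo : ¬ IsOdometer μ T) :
    limsup (fun q : ℕ => (((wordComplexity D.subshift q : ℝ) - 1.5 * (q : ℝ) : ℝ) : EReal)) atTop
        = ⊤ ∧
      liminf (fun q : ℕ => (((wordComplexity D.subshift q : ℝ) - (q : ℝ) : ℝ) : EReal)) atTop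
        = ⊤ := by
  have hS : D.rankOneWords.Nonconstant := by
    by_contra hS
    obtain ⟨N, d, h⟩ := D.exists_constant_spacers hS
    exact hodo (hD.isOdometer hT h)
  obtain ⟨I, hI⟩ := hD
  obtain ⟨K, hK⟩ := hI.exists_length_le hT
  simp only [D.wordComplexity_subshift]
  set p := D.rankOneWords.complexity
  have hlarge : ∀ C : ℝ, ∃ q, C ≤ (p q : ℝ) - 1.5 * q :=
    RankOneWords.exists_complexity_ge hS hK
  have hfreq : ∀ C : ℝ, ∃ᶠ q in atTop, C ≤ (p q : ℝ) - 1.5 * q := by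
    intro C
    rw [frequently_atTop]
    intro N
    -- A value above this sum cannot be attained at any `q < N`.
    obtain ⟨q, hq⟩ := hlarge (max C (∑ k ∈ Finset.range N, |(p k : ℝ) - 1.5 * k| + 1))
    refine ⟨q, ?_, (le_max_left _ _).trans hq⟩
    by_contra hqN
    have h1 := Finset.single_le_sum (f := fun k : ℕ => |(p k : ℝ) - 1.5 * k|)
      (fun k _ => abs_nonneg _) (Finset.mem_range.2 (not_le.1 hqN))
    have h2 := (le_max_right _ _).trans hq
    have h3 := le_abs_self ((p q : ℝ) - 1.5 * q)
    linarith
  constructor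
  · rw [EReal.eq_top_iff_forall_lt]
    intro C
    refine lt_of_lt_of_le (EReal.coe_lt_coe_iff.2 (lt_add_one C)) ?_
    exact le_limsup_of_frequently_le ((hfreq (C + 1)).mono fun q hq => EReal.coe_le_coe_iff.2 hq)
  -- Since `p q - q` is nondecreasing, a single large value bounds all later ones.
  · refine Tendsto.liminf_eq ?_
    rw [EReal.tendsto_nhds_top_iff_real]
    intro C
    obtain ⟨q₀, hq₀⟩ := hlarge (C + 1)
    filter_upwards [eventually_ge_atTop q₀] with q hq
    have h1 := hS.complexity_mono hq
    have h2 : (p q₀ : ℝ) + (q - q₀) ≤ p q := by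
      rw [← Nat.cast_sub hq]; exact_mod_cast h1
    have h3 : (0 : ℝ) ≤ q₀ := by positivity
    rw [EReal.coe_lt_coe_iff]
    norm_num at hq₀
    linarith
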